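/- Let $(\Omega,\mathcal F,P)$ be a probability space with a filtration $(\mathcal F_t)_{t\ge 0}$, let $W=(W_t)_{t\ge0}$ be a standard Brownian motion with respect to $(\mathcal F_t)$, and let $\sigma=(\sigma_t)_{t\ge0}$ be a progressively measurable, strictly stationary, $[0,\infty)$-valued process which is independent of $W$ and not degenerate, i.e. $P(\sigma_0\neq 0)>0$. Let $X=(X_t)_{t\ge0}$ satisfy $dX_t=\sigma_t\,dW_t$, that is, for every $t \ge 0$, almost surely $X_t=X_0+\int_0^t\sigma_s\,dW_s$ (Itô integral). Assume that $$\frac1h\int_0^h(\sigma_s-\sigma_0)^2\,ds\ \longrightarrow\ 0\quad\text{in probability as } h\downarrow 0,$$ and that, for some $p>1$, $$\limsup_{h\downarrow0}\mathbb E\left[\left(\frac1h\int_0^h\sigma_s^2\,ds\right)^{p/2}\right]<+\infty .$$ Then, for every real $q$ with $0<q<p$ and every $t\ge0$, $$A(q):=\limsup_{h\downarrow0}\frac{\log\mathbb E\left[|X_{t+h}-X_t|^q\right]}{\log h}=\frac q2 ,$$ i.e. diffusive scaling holds. -/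

import Mathlib

open MeasureTheory ProbabilityTheory Filter Topology
open scoped NNReal ENNReal

noncomputable section

namespace StochVol

variable {Ω : Type*} {m : MeasurableSpace Ω}

/-- The time integral `∫_0^t f(s)^2 ds`, as an element of `[0, ∞]`, for `f : [0, ∞) → ℝ`. -/
def sqIntegral (f : ℝ≥0 → ℝ) (t : ℝ≥0) : ℝ≥0∞ :=
  ∫⁻ s in Set.Ioc (0 : ℝ) (t : ℝ), ENNReal.ofReal (f s.toNNReal ^ 2)

/-- Convergence to `0` in probability along the filter `l`, for `[0, ∞]`-valued functions. -/
def TendstoZeroInProb {ι : Type*} (P : Measure Ω) (Y : ι → Ω → ℝ≥0∞) (l : Filter ι) : Prop :=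
  ∀ ε : ℝ≥0∞, 0 < ε → Tendsto (fun i => P {ω | ε ≤ Y i ω}) l (𝓝 0)

/-- `W` is a standard Brownian motion relative to the filtration `F`: it is a standard Brownian
motion, it is adapted to `F`, and `W t - W s` is independent of `F s` for `s ≤ t`. -/
structure IsBrownianFor (F : Filtration ℝ≥0 m) (W : ℝ≥0 → Ω → ℝ) (P : Measure Ω) : Prop where
  brownian : IsBrownianReal W P
  adapted : Adapted F W
  indep : ∀ s t, s ≤ t →
    Indep (F s) (MeasurableSpace.comap (fun ω => W t ω - W s ω) inferInstance) P

/-- A bounded simple predictable process `∑_{i < n} ξ_i 1_{(t_i, t_{i+1}]}`, where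
`t_0 ≤ t_1 ≤ …` are deterministic and each `ξ_i` is `F (t_i)`-measurable. -/
structure SimpleProc (F : Filtration ℝ≥0 m) where
  n : ℕ
  time : ℕ → ℝ≥0
  mono : Monotone time
  coeff : ℕ → Ω → ℝ
  bounded : ∃ C : ℝ, ∀ i ω, |coeff i ω| ≤ C
  meas : ∀ i, Measurable[F (time i)] (coeff i)

namespace SimpleProc

variable {F : Filtration ℝ≥0 m}

/-- The value at time `s` of a simple process. -/
def eval (H : SimpleProc F) (s : ℝ≥0) (ω : Ω) : ℝ :=
  ∑ i ∈ Finset.range H.n,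
    (Set.Ioc (H.time i) (H.time (i + 1))).indicator (fun _ => H.coeff i ω) s

/-- The elementary stochastic integral `∫_0^t H dW` of a simple process. -/
def integral (H : SimpleProc F) (W : ℝ≥0 → Ω → ℝ) (t : ℝ≥0) (ω : Ω) : ℝ :=
  ∑ i ∈ Finset.range H.n,
    H.coeff i ω * (W (min (H.time (i + 1)) t) ω - W (min (H.time i) t) ω)

end SimpleProc

/-- `I` is (a version of) the Itô integral `∫_0^t σ_s dW_s` with respect to the `F`-Brownian
motion `W`: there are bounded simple predictable processes `H_k` with
`∫_0^t (H_k - σ)^2 ds → 0` in probability and `∫_0^t H_k dW → I` in probability. -/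
def IsItoIntegral (F : Filtration ℝ≥0 m) (P : Measure Ω) (W σ : ℝ≥0 → Ω → ℝ) (t : ℝ≥0)
    (I : Ω → ℝ) : Prop :=
  ∃ H : ℕ → SimpleProc F,
    TendstoZeroInProb P (fun k ω => sqIntegral (fun s => (H k).eval s ω - σ s ω) t) atTop ∧
    TendstoInMeasure P (fun k => (H k).integral W t) atTop I

/-- Strict stationarity: the law of the whole path is invariant under time shifts. -/
def IsStationary (σ : ℝ≥0 → Ω → ℝ) (P : Measure Ω) : Prop :=
  ∀ r : ℝ≥0, IdentDistrib (fun ω t => σ (t + r) ω) (fun ω t => σ t ω) P P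

/-- `(1/h) ∫_0^h (σ_s - σ_0)^2 ds → 0` in probability as `h ↓ 0`. -/
def WeaklyContAtZero (σ : ℝ≥0 → Ω → ℝ) (P : Measure Ω) : Prop :=
  TendstoZeroInProb P
    (fun (h : ℝ≥0) ω => (h : ℝ≥0∞)⁻¹ * sqIntegral (fun s => σ s ω - σ 0 ω) h) (𝓝[>] 0)

/-- The scaling exponent
`A(q) = limsup_{h ↓ 0} log E[|X_{t+h} - X_t|^q] / log h`, with values in `[-∞, +∞]`. -/
def scalingExponent (P : Measure Ω) (X : ℝ≥0 → Ω → ℝ) (t : ℝ≥0) (q : ℝ) : EReal :=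
  limsup (fun h : ℝ≥0 =>
    ENNReal.log (∫⁻ ω, ENNReal.ofReal |X (t + h) ω - X t ω| ^ q ∂P) /
      ((Real.log (h : ℝ) : ℝ) : EReal)) (𝓝[>] 0)

end StochVol

end

/-! Given the volatility, the increment `X (t + h) - X t` is a centered Gaussian whose variance is
the integral of `σ²` over `[t, t + h]`. By stationarity this variance has the same law as `V`, the
integral over `[0, h]`. Hence the `q`-th absolute moment of the increment is `gaussianMoment q * E[V
^ (q / 2)]`. Factoring out `h ^ (q / 2)` leaves `E[(V / h) ^ (q / 2)]`, which lies between positive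
finite constants for small `h`. The moment hypothesis gives the upper bound
(`eventually_lintegral_rpow_le`); weak continuity at `0` and nondegeneracy give the lower one
(`eventually_le_lintegral_rpow`). Bounded factors disappear after division by `log h`, so the limsup
is in fact a limit.

The work lies in the Gaussian mixture property `charFun_increment`. The Itô integral is only known
as a limit along some simple processes, and these may depend on `W`. An inequality of Lenglart type,
`measure_le_abs_sum`, shows that every approximating sequence yields the same limit. One may
therefore use samplings of the clipped volatility, which are functions of `σ` alone and so
independent of `W`. Conditioning on them gives the characteristic function exactly, and dominated
convergence passes to the limit. Samplings converge because stationarity carries the continuity at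
time `0` to every sampling time. -/

namespace StochVol

variable {Ω : Type*} {m : MeasurableSpace Ω}

/-! ### Squared time integrals and joint measurability. -/

/-- The integral `∫_u^v f(s)^2 ds`, as an element of `[0, ∞]`. -/
noncomputable def sqInt (f : ℝ≥0 → ℝ) (u v : ℝ≥0) : ℝ≥0∞ :=
  ∫⁻ s in Set.Ioc (u : ℝ) (v : ℝ), ENNReal.ofReal (f s.toNNReal ^ 2)

lemma sqIntegral_eq_sqInt (f : ℝ≥0 → ℝ) (t : ℝ≥0) : sqIntegral f t = sqInt f 0 t := rfl

lemma sqInt_mono_set (f : ℝ≥0 → ℝ) {u v u' v' : ℝ≥0} (hu : u ≤ u') (hv : v' ≤ v) :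
    sqInt f u' v' ≤ sqInt f u v :=
  lintegral_mono_set (Set.Ioc_subset_Ioc (by exact_mod_cast hu) (by exact_mod_cast hv))

lemma sqInt_congr {f g : ℝ≥0 → ℝ} {u v : ℝ≥0} (h : ∀ s ∈ Set.Ioc u v, f s = g s) :
    sqInt f u v = sqInt g u v := by
  refine setLIntegral_congr_fun measurableSet_Ioc fun s hs => ?_
  have : s.toNNReal ∈ Set.Ioc u v :=
    ⟨by rw [Real.lt_toNNReal_iff_coe_lt]; exact hs.1, by rw [Real.toNNReal_le_iff_le_coe]; exact hs.2⟩
  simp only [h _ this]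

lemma sqInt_const (c : ℝ) (u v : ℝ≥0) :
    sqInt (fun _ => c) u v = ENNReal.ofReal (c ^ 2 * ((v : ℝ) - u)) := by
  rw [sqInt, setLIntegral_const, Real.volume_Ioc, ENNReal.ofReal_mul (sq_nonneg c)]

lemma sqInt_add_interval (f : ℝ≥0 → ℝ) {u v w : ℝ≥0} (huv : u ≤ v) (hvw : v ≤ w) :
    sqInt f u w = sqInt f u v + sqInt f v w := by
  rw [sqInt, sqInt, sqInt, ← lintegral_union measurableSet_Ioc,
    Set.Ioc_union_Ioc_eq_Ioc (by exact_mod_cast huv) (by exact_mod_cast hvw)]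
  exact Set.Ioc_disjoint_Ioc_of_le le_rfl

lemma sqInt_eq_sum (f : ℝ≥0 → ℝ) {s : ℕ → ℝ≥0} (hs : Monotone s) (N : ℕ) :
    sqInt f (s 0) (s N) = ∑ j ∈ Finset.range N, sqInt f (s j) (s (j + 1)) := by
  induction N with
  | zero => simp [sqInt]
  | succ N ih =>
    rw [Finset.sum_range_succ, ← ih]
    exact sqInt_add_interval f (hs (Nat.zero_le _)) (hs (Nat.le_succ _))

/-- The pointwise bound `(a + b)² ≤ 2 (a² + b²)` serves as a triangle inequality that needs no
finiteness of the integrals. -/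
lemma sqInt_le_two_mul_add {f g k : ℝ≥0 → ℝ} (hf : Measurable f) (hk : Measurable k)
    (u v : ℝ≥0) :
    sqInt (fun s => f s - g s) u v ≤
      2 * (sqInt (fun s => f s - k s) u v + sqInt (fun s => k s - g s) u v) := by
  rw [sqInt, sqInt, sqInt, ← lintegral_add_left (by fun_prop), ← lintegral_const_mul' _ _ (by simp)]
  refine lintegral_mono fun s => ?_
  rw [← ENNReal.ofReal_add (by positivity) (by positivity),
    show (2 : ℝ≥0∞) = ENNReal.ofReal 2 by simp, ← ENNReal.ofReal_mul (by norm_num)]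
  refine ENNReal.ofReal_le_ofReal ?_
  nlinarith [sq_nonneg ((f s.toNNReal - k s.toNNReal) - (k s.toNNReal - g s.toNNReal))]

lemma sqInt_sub_comm (f g : ℝ≥0 → ℝ) (u v : ℝ≥0) :
    sqInt (fun s => f s - g s) u v = sqInt (fun s => g s - f s) u v := by
  simp only [sqInt, sub_sq_comm]

lemma measurable_sqInt {f : ℝ≥0 → Ω → ℝ} (hf : Measurable (Function.uncurry f)) (u v : ℝ≥0) :
    Measurable fun ω => sqInt (fun s => f s ω) u v := by
  refine Measurable.lintegral_prod_right' (f := fun p : Ω × ℝ =>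
    ENNReal.ofReal (f p.2.toNNReal p.1 ^ 2)) ?_
  have : Measurable fun p : Ω × ℝ => f p.2.toNNReal p.1 :=
    hf.comp (measurable_snd.real_toNNReal.prodMk measurable_fst)
  fun_prop

/-- Freezing time at `n` reduces to progressive measurability on `[0, n]`, and at each point the
frozen processes are eventually equal to `f`. -/
lemma measurable_uncurry_of_isProgressive {F : Filtration ℝ≥0 m} {f : ℝ≥0 → Ω → ℝ}
    (hf : IsProgressive F f) : Measurable (Function.uncurry f) := by
  have h (n : ℕ) : Measurable fun p : ℝ≥0 × Ω => f (min p.1 n) p.2 := by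
    have h1 : Measurable fun p : Set.Iic (n : ℝ≥0) × Ω => f p.1 p.2 :=
      (hf n).mono (sup_le_sup le_rfl (MeasurableSpace.comap_mono (F.le _))) le_rfl
    have h2 : Measurable fun p : ℝ≥0 × Ω =>
        ((⟨min p.1 n, Set.mem_Iic.2 (min_le_right _ _)⟩ : Set.Iic (n : ℝ≥0)), p.2) := by
      refine Measurable.prodMk (Measurable.subtype_mk ?_) measurable_snd
      exact measurable_fst.min measurable_const
    exact h1.comp h2
  refine measurable_of_tendsto_metrizable h (tendsto_pi_nhds.2 fun p => ?_)
  obtain ⟨n, hn⟩ := exists_nat_ge p.1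
  refine tendsto_const_nhds.congr' ?_
  filter_upwards [eventually_ge_atTop n] with k hk
  rw [min_eq_left (hn.trans (by exact_mod_cast hk))]
  rfl

/-! ### Simple processes on common refining grids. -/

/-- Every finite set of times is avoided by the gaps of some finite grid of `[u, v]`. -/
lemma exists_grid (S : Finset ℝ≥0) {u v : ℝ≥0} (huv : u ≤ v) :
    ∃ (s : ℕ → ℝ≥0) (N : ℕ), Monotone s ∧ s 0 = u ∧ s N = v ∧
      ∀ x ∈ S, ∀ j, x ≤ s j ∨ s (j + 1) ≤ x := by
  classical
  set T : Finset ℝ≥0 := insert u (insert v (S.filter fun x => u < x ∧ x < v)) with hT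
  have hne : T.Nonempty := ⟨u, by simp [hT]⟩
  obtain ⟨N, hN⟩ : ∃ N, T.card = N + 1 := Nat.exists_eq_succ_of_ne_zero (by simpa using hne.ne_empty)
  have hTu : ∀ x ∈ T, u ≤ x := by
    intro x hx
    simp only [hT, Finset.mem_insert, Finset.mem_filter] at hx
    rcases hx with rfl | rfl | hx
    · exact le_rfl
    · exact huv
    · exact hx.2.1.le
  have hTv : ∀ x ∈ T, x ≤ v := by
    intro x hx
    simp only [hT, Finset.mem_insert, Finset.mem_filter] at hx
    rcases hx with rfl | rfl | hx
    · exact huv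
    · exact le_rfl
    · exact hx.2.2.le
  set e := T.orderEmbOfFin hN
  -- Capping the index at `N` makes the grid constant, equal to `v`, from `N` on, where the gap
  -- condition is trivial.
  have hlt (j : ℕ) : min j N < N + 1 := by omega
  have hsurj (x : ℝ≥0) (hx : x ∈ T) : ∃ i, e i = x := by
    have := Finset.range_orderEmbOfFin T hN
    rw [← Finset.mem_coe, ← this] at hx
    exact hx
  have hmono : Monotone fun j : ℕ => e ⟨min j N, hlt j⟩ := fun a b hab =>
    e.monotone (by simp only [Fin.mk_le_mk]; omega)
  have h0 : e ⟨min 0 N, hlt 0⟩ = u := by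
    refine le_antisymm ?_ (hTu _ (Finset.orderEmbOfFin_mem _ _ _))
    obtain ⟨i, hi⟩ := hsurj u (by simp [hT])
    rw [← hi]
    exact e.monotone (by simp)
  have hNv : e ⟨min N N, hlt N⟩ = v := by
    refine le_antisymm (hTv _ (Finset.orderEmbOfFin_mem _ _ _)) ?_
    obtain ⟨i, hi⟩ := hsurj v (by simp [hT])
    rw [← hi]
    exact e.monotone (by simp only [Fin.le_def]; omega)
  refine ⟨fun j => e ⟨min j N, hlt j⟩, N, hmono, h0, hNv, fun x hx j => ?_⟩
  by_cases hxT : x ∈ T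
  · obtain ⟨i, rfl⟩ := hsurj x hxT
    rcases le_or_gt (i : ℕ) j with hij | hij
    · exact Or.inl (e.monotone (by simp only [Fin.le_def]; omega))
    · exact Or.inr (e.monotone (by simp only [Fin.le_def]; omega))
  · have : x ≤ u ∨ v ≤ x := by
      by_contra! hcon
      exact hxT (by simp [hT, hx, hcon.1, hcon.2])
    rcases this with h | h
    · exact Or.inl (h.trans (hTu _ (Finset.orderEmbOfFin_mem _ _ _)))
    · exact Or.inr ((hTv _ (Finset.orderEmbOfFin_mem _ _ _)).trans h)

/-- No endpoint of `(a, b]` lies strictly inside `(x, y)`, so the interval contains the whole gap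
`(x, y]` or misses it; the value at the right end `y` decides which. -/
lemma indicator_mul_sub_eq {a b x y : ℝ≥0} (hab : a ≤ b) (hxy : x ≤ y) (ha : a ≤ x ∨ y ≤ a)
    (hb : b ≤ x ∨ y ≤ b) (c : ℝ) (f : ℝ≥0 → ℝ) :
    (Set.Ioc a b).indicator (fun _ => c) y * (f y - f x) =
      c * (f (min b y) - f (min a y)) - c * (f (min b x) - f (min a x)) := by
  rcases ha with ha | ha
  · rcases hb with hb | hb
    · rw [min_eq_left hb, min_eq_left ha, min_eq_left (hb.trans hxy), min_eq_left (ha.trans hxy)]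
      by_cases hy : y ∈ Set.Ioc a b
      · rw [le_antisymm hxy (hy.2.trans hb)]; ring
      · rw [Set.indicator_of_notMem hy]; ring
    · rw [min_eq_right hb, min_eq_left ha, min_eq_right (hxy.trans hb), min_eq_left (ha.trans hxy)]
      by_cases hy : y ∈ Set.Ioc a b
      · rw [Set.indicator_of_mem hy]; ring
      · have : x = y := by
          refine le_antisymm hxy ((not_lt.1 fun h => hy ⟨h, hb⟩).trans ha)
        rw [this]; ring
  · rw [min_eq_right ha, min_eq_right (ha.trans hab), min_eq_right (hxy.trans ha),
      min_eq_right ((hxy.trans ha).trans hab),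
      Set.indicator_of_notMem fun h => absurd (h.1.trans_le ha) (lt_irrefl _)]
    ring

namespace SimpleProc

variable {F : Filtration ℝ≥0 m} (H : SimpleProc F)

/-- The grid `s` refines the jump times of `H`. -/
def Refines (s : ℕ → ℝ≥0) : Prop := ∀ i, i ≤ H.n → ∀ j, H.time i ≤ s j ∨ s (j + 1) ≤ H.time i

variable {H} {s : ℕ → ℝ≥0}

lemma integral_sub_integral (hs : Monotone s) (hr : H.Refines s) (W : ℝ≥0 → Ω → ℝ) (N : ℕ)
    (ω : Ω) :
    H.integral W (s N) ω - H.integral W (s 0) ω =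
      ∑ j ∈ Finset.range N, H.eval (s (j + 1)) ω * (W (s (j + 1)) ω - W (s j) ω) := by
  induction N with
  | zero => simp
  | succ N ih =>
    rw [Finset.sum_range_succ, ← ih, SimpleProc.eval, Finset.sum_mul]
    have : ∀ i ∈ Finset.range H.n,
        (Set.Ioc (H.time i) (H.time (i + 1))).indicator (fun _ => H.coeff i ω) (s (N + 1)) *
          (W (s (N + 1)) ω - W (s N) ω) =
        H.coeff i ω * (W (min (H.time (i + 1)) (s (N + 1))) ω - W (min (H.time i) (s (N + 1))) ω) -
        H.coeff i ω * (W (min (H.time (i + 1)) (s N)) ω - W (min (H.time i) (s N)) ω) := by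
      intro i hi
      have hi := Finset.mem_range.1 hi
      exact indicator_mul_sub_eq (H.mono (Nat.le_succ _)) (hs (Nat.le_succ _)) (hr _ hi.le _)
        (hr _ hi _) _ fun r => W r ω
    rw [Finset.sum_congr rfl this, Finset.sum_sub_distrib]
    simp only [SimpleProc.integral]
    ring

lemma integral_zero_right (H : SimpleProc F) (W : ℝ≥0 → Ω → ℝ) (ω : Ω) :
    H.integral W 0 ω = 0 := by
  simp [SimpleProc.integral]

lemma eval_eq_of_mem (hr : H.Refines s) {j : ℕ} {r : ℝ≥0} (h : r ∈ Set.Ioc (s j) (s (j + 1)))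
    (ω : Ω) : H.eval r ω = H.eval (s (j + 1)) ω := by
  refine Finset.sum_congr rfl fun i hi => ?_
  have hi := Finset.mem_range.1 hi
  have h1 := hr i hi.le j
  have h2 := hr (i + 1) hi j
  have : r ∈ Set.Ioc (H.time i) (H.time (i + 1)) ↔
      s (j + 1) ∈ Set.Ioc (H.time i) (H.time (i + 1)) := by
    simp only [Set.mem_Ioc] at h ⊢
    grind
  by_cases hm : r ∈ Set.Ioc (H.time i) (H.time (i + 1))
  · rw [Set.indicator_of_mem hm, Set.indicator_of_mem (this.1 hm)]
  · rw [Set.indicator_of_notMem hm, Set.indicator_of_notMem fun h => hm (this.2 h)]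

/-- This is predictability on the grid: the value on a gap, read off at its right end, is already
known at its left end. The isometry below relies on it. -/
lemma measurable_eval_grid (hr : H.Refines s) (j : ℕ) :
    Measurable[F (s j)] (H.eval (s (j + 1))) := by
  unfold SimpleProc.eval
  refine Finset.measurable_sum _ fun i hi => ?_
  have hi := Finset.mem_range.1 hi
  by_cases hm : s (j + 1) ∈ Set.Ioc (H.time i) (H.time (i + 1))
  · simp only [Set.indicator_of_mem hm]
    refine (H.meas i).mono (F.mono ?_) le_rfl
    rcases hr i hi.le j with h | h
    · exact h
    · exact absurd (hm.1.trans_le h) (lt_irrefl _)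
  · simp only [Set.indicator_of_notMem hm]
    exact measurable_const

lemma measurable_uncurry_eval (H : SimpleProc F) : Measurable (Function.uncurry H.eval) := by
  have : Function.uncurry H.eval = fun p : ℝ≥0 × Ω => ∑ i ∈ Finset.range H.n,
      (Set.Ioc (H.time i) (H.time (i + 1)) ×ˢ (Set.univ : Set Ω)).indicator
        (fun p => H.coeff i p.2) p := by
    ext ⟨r, ω⟩
    simp only [Function.uncurry_apply_pair, SimpleProc.eval]
    refine Finset.sum_congr rfl fun i _ => ?_
    simp [Set.indicator]
  rw [this]
  refine Finset.measurable_sum _ fun i _ => Measurable.indicator ?_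
    (measurableSet_Ioc.prod MeasurableSet.univ)
  exact ((H.meas i).mono (F.le _) le_rfl).comp measurable_snd

lemma exists_abs_eval_le (H : SimpleProc F) : ∃ C : ℝ, 0 ≤ C ∧ ∀ r ω, |H.eval r ω| ≤ C := by
  obtain ⟨C, hC⟩ := H.bounded
  refine ⟨H.n * |C|, by positivity, fun r ω => ?_⟩
  refine (Finset.abs_sum_le_sum_abs _ _).trans ?_
  refine (Finset.sum_le_card_nsmul _ _ |C| fun i _ => ?_).trans (by simp)
  by_cases hm : r ∈ Set.Ioc (H.time i) (H.time (i + 1))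
  · rw [Set.indicator_of_mem hm]
    exact (hC i ω).trans (le_abs_self C)
  · rw [Set.indicator_of_notMem hm]; simp

lemma measurable_integral (H : SimpleProc F) {W : ℝ≥0 → Ω → ℝ} (hW : ∀ t, Measurable (W t))
    (t : ℝ≥0) : Measurable (H.integral W t) := by
  unfold SimpleProc.integral
  refine Finset.measurable_sum _ fun i _ => ?_
  exact ((H.meas i).mono (F.le _) le_rfl).mul ((hW _).sub (hW _))

end SimpleProc

/-- Two simple processes are jointly refined by a finite grid of `[u, v]`. -/
lemma exists_grid_refines {F : Filtration ℝ≥0 m} (H K : SimpleProc F) {u v : ℝ≥0} (huv : u ≤ v) :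
    ∃ (s : ℕ → ℝ≥0) (N : ℕ), Monotone s ∧ s 0 = u ∧ s N = v ∧ H.Refines s ∧ K.Refines s := by
  classical
  obtain ⟨s, N, hs, h0, hN, h⟩ := exists_grid ((Finset.range (H.n + 1)).image H.time ∪
    (Finset.range (K.n + 1)).image K.time) huv
  refine ⟨s, N, hs, h0, hN, fun i hi => h _ ?_, fun i hi => h _ ?_⟩
  · exact Finset.mem_union_left _ (Finset.mem_image_of_mem _ (Finset.mem_range.2 (by omega)))
  · exact Finset.mem_union_right _ (Finset.mem_image_of_mem _ (Finset.mem_range.2 (by omega)))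

lemma sqInt_eval_sub_eval {F : Filtration ℝ≥0 m} {H K : SimpleProc F} {s : ℕ → ℝ≥0}
    (hs : Monotone s) (hH : H.Refines s) (hK : K.Refines s) (N : ℕ) (ω : Ω) :
    sqInt (fun r => H.eval r ω - K.eval r ω) (s 0) (s N) =
      ENNReal.ofReal (∑ j ∈ Finset.range N,
        (H.eval (s (j + 1)) ω - K.eval (s (j + 1)) ω) ^ 2 * ((s (j + 1) : ℝ) - s j)) := by
  have hle (j : ℕ) : (0 : ℝ) ≤ (s (j + 1) : ℝ) - s j :=
    sub_nonneg.2 (by exact_mod_cast hs (Nat.le_succ j))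
  rw [sqInt_eq_sum _ hs, ENNReal.ofReal_sum_of_nonneg fun j _ => by have := hle j; positivity]
  refine Finset.sum_congr rfl fun j _ => ?_
  rw [← sqInt_const]
  exact sqInt_congr fun r hr => by
    rw [SimpleProc.eval_eq_of_mem hH hr, SimpleProc.eval_eq_of_mem hK hr]

/-! ### Itô isometry and control of elementary integrals in probability. -/

section Increments

variable {P : Measure Ω} {F : Filtration ℝ≥0 m} {W : ℝ≥0 → Ω → ℝ}

lemma IsBrownianFor.measurable (hW : IsBrownianFor F W P) (t : ℝ≥0) : Measurable (W t) :=
  hW.adapted.measurable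

lemma IsBrownianFor.indepFun_increment (hW : IsBrownianFor F W P) {s t : ℝ≥0} (hst : s ≤ t)
    {β : Type*} [MeasurableSpace β] {f : Ω → β} (hf : Measurable[F s] f) :
    IndepFun f (fun ω => W t ω - W s ω) P := by
  rw [IndepFun_iff_Indep]
  exact indep_of_indep_of_le_left (hW.indep s t hst) hf.comap_le

lemma IsBrownianFor.hasLaw_increment (hW : IsBrownianFor F W P) {s t : ℝ≥0} (hst : s ≤ t) :
    HasLaw (fun ω => W t ω - W s ω) (gaussianReal 0 (t - s)) P := by
  have h := hW.brownian.hasLaw_sub t s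
  have h2 : nndist t.1 s.1 = t - s := by
    ext
    rw [coe_nndist, Real.dist_eq, NNReal.coe_sub hst]
    exact abs_of_nonneg (sub_nonneg.2 (NNReal.coe_le_coe.2 hst))
  rw [h2] at h
  exact h

lemma IsBrownianFor.integral_increment (hW : IsBrownianFor F W P) {s t : ℝ≥0} (hst : s ≤ t) :
    ∫ ω, (W t ω - W s ω) ∂P = 0 := by
  rw [(hW.hasLaw_increment hst).integral_eq, integral_id_gaussianReal]

lemma IsBrownianFor.memLp_increment (hW : IsBrownianFor F W P) {s t : ℝ≥0} (hst : s ≤ t) :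
    MemLp (fun ω => W t ω - W s ω) 2 P :=
  (hW.hasLaw_increment hst).hasGaussianLaw.memLp_two

lemma IsBrownianFor.integral_increment_sq [IsProbabilityMeasure P] (hW : IsBrownianFor F W P)
    {s t : ℝ≥0} (hst : s ≤ t) :
    ∫ ω, (W t ω - W s ω) ^ 2 ∂P = (t : ℝ) - s := by
  have h := (hW.hasLaw_increment hst).variance_eq
  rw [variance_of_integral_eq_zero (hW.hasLaw_increment hst).aemeasurable
    (hW.integral_increment hst), variance_id_gaussianReal] at h
  rw [h, NNReal.coe_sub hst]

variable {s : ℕ → ℝ≥0} {g : ℕ → Ω → ℝ}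

lemma IsBrownianFor.measurable_sum_increments (hW : IsBrownianFor F W P) (hs : Monotone s)
    (hg : ∀ j, Measurable[F (s j)] (g j)) (N : ℕ) :
    Measurable[F (s N)] fun ω => ∑ j ∈ Finset.range N, g j ω * (W (s (j + 1)) ω - W (s j) ω) := by
  refine Finset.measurable_sum _ fun j hj => ?_
  have hj : j + 1 ≤ N := Finset.mem_range.1 hj
  refine Measurable.mul ?_ (Measurable.sub ?_ ?_)
  · exact (hg j).mono (F.mono (hs (by omega))) le_rfl
  · exact (hW.adapted _).mono (F.mono (hs hj)) le_rfl
  · exact (hW.adapted _).mono (F.mono (hs (by omega))) le_rfl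

lemma memLp_two_mul_bounded {f k : Ω → ℝ} (hf : Measurable f) {C : ℝ} (hC : ∀ ω, |f ω| ≤ C)
    (hk : MemLp k 2 P) : MemLp (fun ω => f ω * k ω) 2 P := by
  have hf' : MemLp f ⊤ P := memLp_top_of_bound hf.aestronglyMeasurable C (ae_of_all _ hC)
  exact hk.mul' hf'

variable [IsProbabilityMeasure P]

/-- The Itô isometry for elementary integrals. -/
lemma IsBrownianFor.memLp_and_integral_sum_sq (hW : IsBrownianFor F W P) (hs : Monotone s)
    (hg : ∀ j, Measurable[F (s j)] (g j)) (hb : ∀ j, ∃ C : ℝ, ∀ ω, |g j ω| ≤ C) (N : ℕ) :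
    MemLp (fun ω => ∑ j ∈ Finset.range N, g j ω * (W (s (j + 1)) ω - W (s j) ω)) 2 P ∧
    ∫ ω, (∑ j ∈ Finset.range N, g j ω * (W (s (j + 1)) ω - W (s j) ω)) ^ 2 ∂P =
      ∑ j ∈ Finset.range N, (∫ ω, g j ω ^ 2 ∂P) * ((s (j + 1) : ℝ) - s j) := by
  induction N with
  | zero => simp
  | succ N ih =>
    obtain ⟨ih1, ih2⟩ := ih
    obtain ⟨C, hC⟩ := hb N
    have hle := hs (Nat.le_succ N)
    have hM := hW.measurable_sum_increments hs hg N
    have hgN : Measurable (g N) := (hg N).mono (F.le _) le_rfl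
    have hd := hW.memLp_increment hle
    have hgd := memLp_two_mul_bounded hgN hC hd
    set M : Ω → ℝ := fun ω => ∑ j ∈ Finset.range N, g j ω * (W (s (j + 1)) ω - W (s j) ω) with hMdef
    have hgM : MemLp (fun ω => g N ω * M ω) 2 P := memLp_two_mul_bounded hgN hC ih1
    simp only [Finset.sum_range_succ]
    refine ⟨ih1.add hgd, ?_⟩
    -- The new increment is independent of the past and centered, so the cross term integrates to
    -- zero.
    have h1 : ∀ ω, (M ω + g N ω * (W (s (N + 1)) ω - W (s N) ω)) ^ 2 =
        M ω ^ 2 + 2 * ((g N ω * M ω) * (W (s (N + 1)) ω - W (s N) ω)) +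
          (g N ω) ^ 2 * (W (s (N + 1)) ω - W (s N) ω) ^ 2 := fun ω => by ring
    have hi1 : Integrable (fun ω => M ω ^ 2) P := ih1.integrable_sq
    have hi2 : Integrable (fun ω => 2 * ((g N ω * M ω) * (W (s (N + 1)) ω - W (s N) ω))) P :=
      (hgM.integrable_mul hd).const_mul 2
    have hi3 : Integrable (fun ω => (g N ω) ^ 2 * (W (s (N + 1)) ω - W (s N) ω) ^ 2) P := by
      simpa only [mul_pow] using hgd.integrable_sq
    have e2 : ∫ ω, (g N ω * M ω) * (W (s (N + 1)) ω - W (s N) ω) ∂P = 0 := by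
      have hind := hW.indepFun_increment hle ((hg N).mul hM)
      have := hind.integral_fun_mul_eq_mul_integral (X := fun ω => g N ω * M ω)
        hgM.aestronglyMeasurable hd.aestronglyMeasurable
      rw [this, hW.integral_increment hle, mul_zero]
    have e3 : ∫ ω, (g N ω) ^ 2 * (W (s (N + 1)) ω - W (s N) ω) ^ 2 ∂P =
        (∫ ω, g N ω ^ 2 ∂P) * ((s (N + 1) : ℝ) - s N) := by
      have hind := (hW.indepFun_increment hle (hg N)).comp (φ := fun x : ℝ => x ^ 2)
        (ψ := fun x : ℝ => x ^ 2) (by fun_prop) (by fun_prop)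
      have := hind.integral_fun_mul_eq_mul_integral
        (hgN.pow_const 2).aestronglyMeasurable
        hd.integrable_sq.aestronglyMeasurable
      simp only [Function.comp_def] at this
      rw [this, hW.integral_increment_sq hle]
    have hi12 : Integrable (fun ω => M ω ^ 2 +
        2 * ((g N ω * M ω) * (W (s (N + 1)) ω - W (s N) ω))) P := hi1.add hi2
    rw [integral_congr_ae (ae_of_all _ h1), integral_add hi12 hi3, integral_add hi1 hi2,
      integral_const_mul, e2, e3, ih2, mul_zero, add_zero]

/-- Control in probability of an elementary integral by its quadratic variation. -/
lemma IsBrownianFor.measure_le_abs_sum (hW : IsBrownianFor F W P) (hs : Monotone s)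
    (hg : ∀ j, Measurable[F (s j)] (g j)) (hb : ∀ j, ∃ C : ℝ, ∀ ω, |g j ω| ≤ C) (N : ℕ)
    {ε δ : ℝ} (hε : 0 < ε) (hδ : 0 ≤ δ) :
    P {ω | ε ≤ |∑ j ∈ Finset.range N, g j ω * (W (s (j + 1)) ω - W (s j) ω)|} ≤
      ENNReal.ofReal (δ / ε ^ 2) +
        P {ω | δ ≤ ∑ j ∈ Finset.range N, g j ω ^ 2 * ((s (j + 1) : ℝ) - s j)} := by
  classical
  have hle (j : ℕ) : (0 : ℝ) ≤ (s (j + 1) : ℝ) - s j :=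
    sub_nonneg.2 (by exact_mod_cast hs (Nat.le_succ j))
  set A : ℕ → Ω → ℝ := fun n ω => ∑ j ∈ Finset.range n, g j ω ^ 2 * ((s (j + 1) : ℝ) - s j) with hA
  have hAmono (ω : Ω) : Monotone fun n => A n ω := by
    refine monotone_nat_of_le_succ fun n => ?_
    simp only [hA, Finset.sum_range_succ]
    have := mul_nonneg (sq_nonneg (g n ω)) (hle n)
    linarith
  -- The index shift is essential: `A (j + 1)` involves only `g 0, …, g j`, so it is known at time
  -- `s j` and the truncation below stays predictable.
  have hAmeas (j : ℕ) : Measurable[F (s j)] (A (j + 1)) := by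
    refine Finset.measurable_sum _ fun i hi => ?_
    have hi := Finset.mem_range.1 hi
    exact (((hg i).mono (F.mono (hs (by omega))) le_rfl).pow_const 2).mul_const _
  set k : ℕ → Ω → ℝ := fun j => {ω | A (j + 1) ω < δ}.indicator (g j) with hk
  have hkmeas (j : ℕ) : Measurable[F (s j)] (k j) :=
    (hg j).indicator (measurableSet_lt (hAmeas j) measurable_const)
  have hkb (j : ℕ) : ∃ C : ℝ, ∀ ω, |k j ω| ≤ C := by
    obtain ⟨C, hC⟩ := hb j
    refine ⟨C, fun ω => ?_⟩
    simp only [hk, Set.indicator]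
    split_ifs
    · exact hC ω
    · simpa using (abs_nonneg _).trans (hC ω)
  -- The truncated quadratic variation never exceeds `δ`. The bound by `A n ω` is carried along
  -- because the case `A (n + 1) ω < δ` of the induction needs it.
  have hksum (ω : Ω) (n : ℕ) :
      ∑ j ∈ Finset.range n, k j ω ^ 2 * ((s (j + 1) : ℝ) - s j) ≤ min (A n ω) δ := by
    induction n with
    | zero => simpa [hA] using hδ
    | succ n ih =>
      rw [Finset.sum_range_succ]
      have hsucc : A (n + 1) ω = A n ω + g n ω ^ 2 * ((s (n + 1) : ℝ) - s n) := by
        simp only [hA, Finset.sum_range_succ]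
      by_cases h : A (n + 1) ω < δ
      · have : k n ω = g n ω := Set.indicator_of_mem (s := {ω | A (n + 1) ω < δ}) h _
        rw [this, min_eq_left h.le, hsucc]
        linarith [ih.trans (min_le_left _ _)]
      · have : k n ω = 0 := Set.indicator_of_notMem (s := {ω | A (n + 1) ω < δ}) h _
        rw [this, zero_pow two_ne_zero, zero_mul, add_zero]
        exact ih.trans (min_le_min_right _ (hAmono ω (Nat.le_succ n)))
  obtain ⟨hL2, hiso⟩ := hW.memLp_and_integral_sum_sq hs hkmeas hkb N
  have hbound : ∫ ω, (∑ j ∈ Finset.range N, k j ω * (W (s (j + 1)) ω - W (s j) ω)) ^ 2 ∂P ≤ δ := by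
    have hint (j : ℕ) : Integrable (fun ω => k j ω ^ 2 * ((s (j + 1) : ℝ) - s j)) P := by
      obtain ⟨C, hC⟩ := hkb j
      have : MemLp (k j) 2 P := (memLp_top_of_bound
        ((hkmeas j).mono (F.le _) le_rfl).aestronglyMeasurable C (ae_of_all _ hC)).mono_exponent
          le_top
      exact this.integrable_sq.mul_const _
    rw [hiso]
    simp_rw [← integral_mul_const]
    rw [← integral_finsetSum _ fun j _ => hint j]
    refine (integral_mono (integrable_finsetSum _ fun j _ => hint j) (integrable_const δ)
      fun ω => (hksum ω N).trans (min_le_right _ _)).trans (by simp)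
  have hcheb : P {ω | ε ≤ |∑ j ∈ Finset.range N, k j ω * (W (s (j + 1)) ω - W (s j) ω)|} ≤
      ENNReal.ofReal (δ / ε ^ 2) := by
    have := mul_meas_ge_le_integral_of_nonneg (μ := P) (ae_of_all _ fun ω => sq_nonneg
      (∑ j ∈ Finset.range N, k j ω * (W (s (j + 1)) ω - W (s j) ω))) hL2.integrable_sq (ε ^ 2)
    have hset : {ω | ε ≤ |∑ j ∈ Finset.range N, k j ω * (W (s (j + 1)) ω - W (s j) ω)|} =
        {ω | ε ^ 2 ≤ (∑ j ∈ Finset.range N, k j ω * (W (s (j + 1)) ω - W (s j) ω)) ^ 2} := by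
      ext ω
      simp only [Set.mem_ofPred_eq]
      rw [← sq_abs (∑ j ∈ Finset.range N, _)]
      exact (pow_le_pow_iff_left₀ hε.le (abs_nonneg _) two_ne_zero).symm
    rw [hset, ← ENNReal.ofReal_toReal (measure_ne_top P _)]
    refine ENNReal.ofReal_le_ofReal ?_
    rw [le_div_iff₀ (by positivity), mul_comm]
    exact this.trans hbound
  -- Where the full quadratic variation is below `δ`, no coefficient has been cut off and the two
  -- sums agree; elsewhere the second probability pays.
  refine le_trans (measure_mono fun ω hω => ?_) ((measure_union_le _ _).trans
    (add_le_add_left hcheb _))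
  by_cases h : δ ≤ A N ω
  · exact Or.inr h
  · left
    have : ∑ j ∈ Finset.range N, k j ω * (W (s (j + 1)) ω - W (s j) ω) =
        ∑ j ∈ Finset.range N, g j ω * (W (s (j + 1)) ω - W (s j) ω) := by
      refine Finset.sum_congr rfl fun j hj => ?_
      have hj : j + 1 ≤ N := Finset.mem_range.1 hj
      rw [show k j ω = g j ω from Set.indicator_of_mem (s := {ω | A (j + 1) ω < δ})
        ((hAmono ω hj).trans_lt (not_le.1 h)) _]
    change ε ≤ |∑ j ∈ Finset.range N, k j ω * (W (s (j + 1)) ω - W (s j) ω)|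
    rw [this]
    exact hω

lemma IsBrownianFor.measure_le_abs_integral_sub (hW : IsBrownianFor F W P) (H K : SimpleProc F)
    {u v : ℝ≥0} (huv : u ≤ v) {ε δ : ℝ} (hε : 0 < ε) (hδ : 0 < δ) :
    P {ω | ε ≤ |(H.integral W v ω - H.integral W u ω) -
        (K.integral W v ω - K.integral W u ω)|} ≤
      ENNReal.ofReal (δ / ε ^ 2) +
        P {ω | ENNReal.ofReal δ ≤ sqInt (fun r => H.eval r ω - K.eval r ω) u v} := by
  obtain ⟨s, N, hs, rfl, rfl, hH, hK⟩ := exists_grid_refines H K huv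
  obtain ⟨C, -, hC⟩ := H.exists_abs_eval_le
  obtain ⟨D, -, hD⟩ := K.exists_abs_eval_le
  have := hW.measure_le_abs_sum (P := P) hs
    (g := fun j ω => H.eval (s (j + 1)) ω - K.eval (s (j + 1)) ω)
    (fun j => (SimpleProc.measurable_eval_grid hH j).sub (SimpleProc.measurable_eval_grid hK j))
    (fun j => ⟨C + D, fun ω => (abs_sub _ _).trans (add_le_add (hC _ _) (hD _ _))⟩) N hε hδ.le
  simp only [SimpleProc.integral_sub_integral hs hH, SimpleProc.integral_sub_integral hs hK,
    sqInt_eval_sub_eval hs hH hK, ← Finset.sum_sub_distrib, ← sub_mul]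
  refine this.trans (add_le_add_right (measure_mono fun ω hω => ENNReal.ofReal_le_ofReal hω) _)

/-- Elementary integrals of simple processes whose squared distance tends to `0` in probability
have the same limits in probability. -/
lemma IsBrownianFor.tendstoInMeasure_integral_sub (hW : IsBrownianFor F W P)
    {H K : ℕ → SimpleProc F} {u v : ℝ≥0} (huv : u ≤ v)
    (h : TendstoZeroInProb P (fun k ω => sqInt (fun r => (H k).eval r ω - (K k).eval r ω) u v)
      atTop) :
    TendstoInMeasure P (fun k ω => ((H k).integral W v ω - (H k).integral W u ω) -
        ((K k).integral W v ω - (K k).integral W u ω)) atTop fun _ => 0 := by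
  rw [tendstoInMeasure_iff_norm]
  intro ε hε
  rw [ENNReal.tendsto_atTop_zero]
  intro η hη
  obtain ⟨b, hb0, hb⟩ : ∃ b : ℝ, 0 < b ∧ ENNReal.ofReal b ≤ η / 2 := by
    obtain ⟨c, hc0, hc⟩ := ENNReal.lt_iff_exists_nnreal_btwn.1 (ENNReal.half_pos hη.ne')
    exact ⟨c, by simpa using hc0, by simpa using hc.le⟩
  -- With `δ = b ε²` the Chebyshev term `δ / ε²` equals `b ≤ η / 2`.
  have hδ : 0 < b * ε ^ 2 := by positivity
  obtain ⟨k, hk⟩ := ENNReal.tendsto_atTop_zero.1 (h _ (ENNReal.ofReal_pos.2 hδ)) (η / 2)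
    (ENNReal.half_pos hη.ne')
  refine ⟨k, fun n hn => ?_⟩
  have := hW.measure_le_abs_integral_sub (H n) (K n) huv hε hδ
  simp only [sub_zero, Real.norm_eq_abs]
  refine this.trans ?_
  rw [mul_div_assoc, div_self (by positivity), mul_one, ← ENNReal.add_halves η]
  exact add_le_add hb (hk n hn)

end Increments

/-! ### Simple processes on their own jump grid. -/

namespace SimpleProc

variable {F : Filtration ℝ≥0 m} (H : SimpleProc F)

lemma eval_eq_coeff {j : ℕ} (hj : j < H.n) {r : ℝ≥0}
    (hr : r ∈ Set.Ioc (H.time j) (H.time (j + 1))) (ω : Ω) : H.eval r ω = H.coeff j ω := by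
  unfold SimpleProc.eval
  rw [Finset.sum_eq_single_of_mem j (Finset.mem_range.2 hj), Set.indicator_of_mem hr]
  intro i _ hij
  refine Set.indicator_of_notMem (fun h => ?_) _
  rcases lt_or_gt_of_ne hij with hlt | hlt
  · exact absurd ((h.2.trans (H.mono hlt)).trans_lt hr.1) (lt_irrefl _)
  · exact absurd ((hr.2.trans (H.mono hlt)).trans_lt h.1) (lt_irrefl _)

lemma integral_sub_integral_eq_sum (W : ℝ≥0 → Ω → ℝ) (ω : Ω) :
    H.integral W (H.time H.n) ω - H.integral W (H.time 0) ω =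
      ∑ i ∈ Finset.range H.n, H.coeff i ω * (W (H.time (i + 1)) ω - W (H.time i) ω) := by
  unfold SimpleProc.integral
  rw [← Finset.sum_sub_distrib]
  refine Finset.sum_congr rfl fun i hi => ?_
  have hi : i + 1 ≤ H.n := Finset.mem_range.1 hi
  rw [min_eq_left (H.mono hi), min_eq_left (H.mono (by omega)), min_eq_right (H.mono (by omega)),
    min_eq_right (H.mono (by omega))]
  ring

lemma sqInt_eval : ∀ ω, sqInt (fun r => H.eval r ω) (H.time 0) (H.time H.n) =
    ENNReal.ofReal (∑ i ∈ Finset.range H.n,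
      H.coeff i ω ^ 2 * ((H.time (i + 1) : ℝ) - H.time i)) := by
  intro ω
  have hle (j : ℕ) : (0 : ℝ) ≤ (H.time (j + 1) : ℝ) - H.time j :=
    sub_nonneg.2 (by exact_mod_cast H.mono (Nat.le_succ j))
  rw [sqInt_eq_sum _ H.mono, ENNReal.ofReal_sum_of_nonneg fun j _ => by have := hle j; positivity]
  refine Finset.sum_congr rfl fun j hj => ?_
  rw [← sqInt_const]
  exact sqInt_congr fun r hr => H.eval_eq_coeff (Finset.mem_range.1 hj) hr ω

end SimpleProc

/-! ### Characteristic functions of elementary integrals with independent coefficients. -/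

section Gaussian

variable {P : Measure Ω} [IsProbabilityMeasure P] {F : Filtration ℝ≥0 m} {W : ℝ≥0 → Ω → ℝ}
  {s : ℕ → ℝ≥0}

lemma IsBrownianFor.map_sum_increments (hW : IsBrownianFor F W P) (hs : Monotone s) (c : ℕ → ℝ)
    (N : ℕ) :
    P.map (fun ω => ∑ j ∈ Finset.range N, c j * (W (s (j + 1)) ω - W (s j) ω)) =
      gaussianReal 0 (∑ j ∈ Finset.range N, .mk (c j ^ 2) (sq_nonneg _) * (s (j + 1) - s j)) := by
  induction N with
  | zero => simp
  | succ N ih =>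
    have hle := hs (Nat.le_succ N)
    have hM := hW.measurable_sum_increments hs (g := fun j _ => c j)
      (fun _ => measurable_const) N
    have hind := (hW.indepFun_increment hle hM).comp (φ := id) (ψ := fun x => c N * x)
      measurable_id (by fun_prop)
    have h2 := (gaussianReal_const_mul (hW.hasLaw_increment hle) (c N)).map_eq
    have := gaussianReal_add_gaussianReal_of_indepFun hind ih h2
    simp only [mul_zero, add_zero] at this
    simp only [Finset.sum_range_succ]
    exact this

lemma IsBrownianFor.integral_cexp_sum_increments (hW : IsBrownianFor F W P) (hs : Monotone s)
    (c : ℕ → ℝ) (N : ℕ) (u : ℝ) :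
    ∫ ω, Complex.exp (u * (∑ j ∈ Finset.range N, c j * (W (s (j + 1)) ω - W (s j) ω) : ℝ) *
      Complex.I) ∂P =
      Complex.exp (-((∑ j ∈ Finset.range N, c j ^ 2 * ((s (j + 1) : ℝ) - s j) : ℝ) *
        u ^ 2 / 2)) := by
  have hmeas : Measurable fun ω => ∑ j ∈ Finset.range N, c j * (W (s (j + 1)) ω - W (s j) ω) :=
    Finset.measurable_sum _ fun j _ => ((hW.measurable _).sub (hW.measurable _)).const_mul _
  have h := charFun_gaussianReal (μ := 0)
    (v := ∑ j ∈ Finset.range N, .mk (c j ^ 2) (sq_nonneg _) * (s (j + 1) - s j)) u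
  rw [← hW.map_sum_increments hs c N, charFun_apply_real, integral_map hmeas.aemeasurable
    (by fun_prop)] at h
  rw [h]
  congr 1
  simp only [Complex.ofReal_zero, mul_zero, zero_mul, zero_sub, neg_inj]
  congr 2
  have hsub (j : ℕ) : ((s (j + 1) - s j : ℝ≥0) : ℝ) = (s (j + 1) : ℝ) - s j :=
    NNReal.coe_sub (hs (Nat.le_succ j))
  push_cast
  refine Finset.sum_congr rfl fun j _ => ?_
  rw [← Complex.ofReal_sub, ← hsub]

/-- Conditioning on coefficients which are independent of the Brownian motion. -/
lemma IsBrownianFor.integral_cexp_sum_increments_of_indepFun (hW : IsBrownianFor F W P)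
    (hs : Monotone s) {κ : ℕ → Ω → ℝ} (hκ : ∀ i, Measurable (κ i))
    (hind : IndepFun (fun ω i => κ i ω) (fun ω t => W t ω) P) (N : ℕ) (u : ℝ) :
    ∫ ω, Complex.exp (u * (∑ j ∈ Finset.range N, κ j ω * (W (s (j + 1)) ω - W (s j) ω) : ℝ) *
      Complex.I) ∂P =
    ∫ ω, Complex.exp (-((∑ j ∈ Finset.range N, κ j ω ^ 2 * ((s (j + 1) : ℝ) - s j) : ℝ) *
      u ^ 2 / 2)) ∂P := by
  have hκ' : Measurable fun ω i => κ i ω := measurable_pi_lambda _ hκ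
  have hD : Measurable fun ω (j : ℕ) => W (s (j + 1)) ω - W (s j) ω :=
    measurable_pi_lambda _ fun j => (hW.measurable _).sub (hW.measurable _)
  have hind' : IndepFun (fun ω i => κ i ω) (fun ω (j : ℕ) => W (s (j + 1)) ω - W (s j) ω) P :=
    hind.comp (φ := id) (ψ := fun (w : ℝ≥0 → ℝ) (j : ℕ) => w (s (j + 1)) - w (s j))
      measurable_id (by fun_prop)
  have hprod := (indepFun_iff_map_prod_eq_prod_map_map hκ'.aemeasurable hD.aemeasurable).1 hind'
  set f : (ℕ → ℝ) × (ℕ → ℝ) → ℂ := fun p =>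
    Complex.exp (u * (∑ j ∈ Finset.range N, p.1 j * p.2 j : ℝ) * Complex.I) with hf
  have hfm : Measurable f := by
    have : Measurable fun p : (ℕ → ℝ) × (ℕ → ℝ) => ∑ j ∈ Finset.range N, p.1 j * p.2 j :=
      Finset.measurable_sum _ fun j _ => by fun_prop
    fun_prop
  have hfb (p) : ‖f p‖ = 1 := by
    simp only [hf, ← Complex.ofReal_mul]
    exact Complex.norm_exp_ofReal_mul_I _
  have : IsProbabilityMeasure (P.map fun ω i => κ i ω) :=
    Measure.isProbabilityMeasure_map hκ'.aemeasurable
  have : IsProbabilityMeasure (P.map fun ω (j : ℕ) => W (s (j + 1)) ω - W (s j) ω) :=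
    Measure.isProbabilityMeasure_map hD.aemeasurable
  have hfi : Integrable f ((P.map fun ω i => κ i ω).prod
      (P.map fun ω (j : ℕ) => W (s (j + 1)) ω - W (s j) ω)) :=
    .of_bound hfm.aestronglyMeasurable 1 (ae_of_all _ fun p => (hfb p).le)
  -- Independence turns the joint law into a product, so Fubini allows the coefficients to be frozen
  -- at `c` and the deterministic case applied.
  calc _ = ∫ p, f p ∂(P.map fun ω => ((fun i => κ i ω),
            fun j : ℕ => W (s (j + 1)) ω - W (s j) ω)) :=
        (integral_map (hκ'.prodMk hD).aemeasurable hfm.aestronglyMeasurable).symm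
    _ = ∫ c, ∫ d, f (c, d) ∂(P.map fun ω (j : ℕ) => W (s (j + 1)) ω - W (s j) ω)
          ∂(P.map fun ω i => κ i ω) := by rw [hprod, integral_prod _ hfi]
    _ = ∫ c : ℕ → ℝ, Complex.exp (-((∑ j ∈ Finset.range N,
          c j ^ 2 * ((s (j + 1) : ℝ) - s j) : ℝ) * u ^ 2 / 2)) ∂(P.map fun ω i => κ i ω) := by
        refine integral_congr_ae (ae_of_all _ fun c => ?_)
        change ∫ d, f (c, d) ∂(P.map fun ω (j : ℕ) => W (s (j + 1)) ω - W (s j) ω) = _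
        have hfc : Measurable fun d => f (c, d) := hfm.comp measurable_prodMk_left
        rw [integral_map hD.aemeasurable hfc.aestronglyMeasurable]
        exact hW.integral_cexp_sum_increments hs c N u
    _ = _ := by
        refine integral_map hκ'.aemeasurable (Measurable.aestronglyMeasurable ?_)
        have : Measurable fun c : ℕ → ℝ => ∑ j ∈ Finset.range N,
            c j ^ 2 * ((s (j + 1) : ℝ) - s j) :=
          Finset.measurable_sum _ fun j _ => by fun_prop
        fun_prop

end Gaussian

/-! ### Samplings of the clipped volatility. -/

section Sampling

variable {F : Filtration ℝ≥0 m} {σ : ℝ≥0 → Ω → ℝ}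

/-- The simple process which samples `min σ M` at the left ends of `n + 1` intervals of equal
length in `[t, t + h]`. -/
noncomputable def sampling (hσ : Adapted F σ) (hσ0 : ∀ t ω, 0 ≤ σ t ω) (t h : ℝ≥0) (M n : ℕ) :
    SimpleProc F where
  -- Using `n + 1` pieces keeps the mesh `h / (n + 1)` meaningful for every `n`.
  n := n + 1
  time i := t + i * (h / (n + 1))
  mono i j hij := add_le_add_right (mul_le_mul_left (Nat.cast_le.2 hij) _) _
  coeff i ω := min (σ (t + i * (h / (n + 1))) ω) M
  bounded := ⟨M, fun i ω => by
    rw [abs_of_nonneg (le_min (hσ0 _ _) (Nat.cast_nonneg _))]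
    exact min_le_right _ _⟩
  meas i := (hσ _).min measurable_const

variable (hσ : Adapted F σ) (hσ0 : ∀ t ω, 0 ≤ σ t ω) (t h : ℝ≥0) (M n : ℕ)

lemma sampling_time_zero : (sampling hσ hσ0 t h M n).time 0 = t := by simp [sampling]

lemma sampling_time_n :
    (sampling hσ hσ0 t h M n).time (sampling hσ hσ0 t h M n).n = t + h := by
  simp only [sampling, Nat.cast_add, Nat.cast_one]
  rw [mul_div_cancel₀]
  positivity

/-- The characteristic function of the elementary integral of a sampled volatility, independent
of the Brownian motion. -/
lemma integral_cexp_sampling {P : Measure Ω} [IsProbabilityMeasure P] {W : ℝ≥0 → Ω → ℝ}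
    (hW : IsBrownianFor F W P) (hind : IndepFun (fun ω t => σ t ω) (fun ω t => W t ω) P) (u : ℝ) :
    ∫ ω, Complex.exp (u * ((sampling hσ hσ0 t h M n).integral W (t + h) ω -
      (sampling hσ hσ0 t h M n).integral W t ω : ℝ) * Complex.I) ∂P =
    ∫ ω, Complex.exp (-((sqInt (fun r => (sampling hσ hσ0 t h M n).eval r ω) t (t + h)).toReal *
      u ^ 2 / 2)) ∂P := by
  set K := sampling hσ hσ0 t h M n with hK
  have h0 : K.time 0 = t := sampling_time_zero hσ hσ0 t h M n
  have hn : K.time K.n = t + h := sampling_time_n hσ hσ0 t h M n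
  have hle (j : ℕ) : (0 : ℝ) ≤ (K.time (j + 1) : ℝ) - K.time j :=
    sub_nonneg.2 (by exact_mod_cast K.mono (Nat.le_succ j))
  have hnn (ω : Ω) : 0 ≤ ∑ i ∈ Finset.range K.n,
      K.coeff i ω ^ 2 * ((K.time (i + 1) : ℝ) - K.time i) :=
    Finset.sum_nonneg fun i _ => mul_nonneg (sq_nonneg _) (hle i)
  have hind' : IndepFun (fun ω i => K.coeff i ω) (fun ω t => W t ω) P :=
    hind.comp (φ := fun (x : ℝ≥0 → ℝ) (i : ℕ) => min (x (t + i * (h / (n + 1)))) M) (ψ := id)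
      (by fun_prop) measurable_id
  have := hW.integral_cexp_sum_increments_of_indepFun K.mono (κ := K.coeff)
    (fun i => (K.meas i).mono (F.le _) le_rfl) hind' K.n u
  simp only [← K.integral_sub_integral_eq_sum, h0, hn] at this
  rw [this]
  refine integral_congr_ae (ae_of_all _ fun ω => ?_)
  have h2 := K.sqInt_eval ω
  rw [h0, hn] at h2
  simp only [h2, ENNReal.toReal_ofReal (hnn ω)]

/-- By stationarity the sampled quadratic variations over `[t, t + h]` and `[0, h]` have the
same law. -/
lemma identDistrib_sqInt_sampling {P : Measure Ω} (hst : IsStationary σ P) :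
    IdentDistrib (fun ω => sqInt (fun r => (sampling hσ hσ0 t h M n).eval r ω) t (t + h))
      (fun ω => sqInt (fun r => (sampling hσ hσ0 0 h M n).eval r ω) 0 h) P P := by
  have key (a : ℝ≥0) (ω : Ω) :
      sqInt (fun r => (sampling hσ hσ0 a h M n).eval r ω) a (a + h) =
      ENNReal.ofReal (∑ i ∈ Finset.range (n + 1),
        (min (σ (i * (h / (n + 1)) + a) ω) M) ^ 2 * (h / (n + 1))) := by
    have h2 := (sampling hσ hσ0 a h M n).sqInt_eval ω
    rw [sampling_time_zero, sampling_time_n] at h2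
    rw [h2]
    congr 1
    refine Finset.sum_congr rfl fun i _ => ?_
    simp only [sampling, add_comm a]
    push_cast
    ring
  have key0 := key 0
  simp only [zero_add, add_zero] at key0
  simp only [key, key0]
  -- Stationarity is an equality of laws on the product σ-algebra, so it applies to this functional
  -- of finitely many coordinates. It is transferred to the integral of `σ²` only by a later limit.
  exact (hst t).comp (u := fun x : ℝ≥0 → ℝ => ENNReal.ofReal (∑ i ∈ Finset.range (n + 1),
        (min (x (i * (h / (n + 1)))) M) ^ 2 * (h / (n + 1)))) (by
    refine Measurable.ennreal_ofReal (Finset.measurable_sum _ fun i _ => ?_)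
    fun_prop)

end Sampling

/-! ### Convergence in probability to zero with values in `[0, ∞]`. -/

section ConvergenceInProbability

variable {P : Measure Ω} {ι : Type*} {l : Filter ι} {Y Z : ι → Ω → ℝ≥0∞}

lemma TendstoZeroInProb.mono (hY : TendstoZeroInProb P Y l) (h : ∀ i ω, Z i ω ≤ Y i ω) :
    TendstoZeroInProb P Z l := fun ε hε =>
  tendsto_of_tendsto_of_tendsto_of_le_of_le tendsto_const_nhds (hY ε hε) (fun _ => zero_le)
    fun i => measure_mono fun ω hω => le_trans hω (h i ω)

lemma TendstoZeroInProb.two_mul_add (hY : TendstoZeroInProb P Y l) (hZ : TendstoZeroInProb P Z l) :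
    TendstoZeroInProb P (fun i ω => 2 * (Y i ω + Z i ω)) l := by
  intro ε hε
  have hε4 : 0 < ε / 2 / 2 := ENNReal.half_pos (ENNReal.half_pos hε.ne').ne'
  have := (hY _ hε4).add (hZ _ hε4)
  rw [add_zero] at this
  refine tendsto_of_tendsto_of_tendsto_of_le_of_le tendsto_const_nhds this (fun _ => zero_le)
    fun i => (measure_mono fun ω hω => ?_).trans (measure_union_le _ _)
  by_contra hcon
  have h1 : Y i ω < ε / 2 / 2 := not_le.1 fun h => hcon (Or.inl h)
  have h2 : Z i ω < ε / 2 / 2 := not_le.1 fun h => hcon (Or.inr h)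
  have h3 : Y i ω + Z i ω < ε / 2 := by
    exact (ENNReal.add_lt_add h1 h2).trans_eq (ENNReal.add_halves _)
  have h4 : 2 * (Y i ω + Z i ω) < ε := by
    refine (ENNReal.mul_lt_mul_right (by simp) (by simp) h3).trans_le ?_
    rw [ENNReal.mul_div_cancel (by simp) (by simp)]
  exact absurd hω (not_le.2 h4)

lemma TendstoZeroInProb.comp {κ : Type*} {l' : Filter κ} (hY : TendstoZeroInProb P Y l) {k : κ → ι}
    (hk : Tendsto k l' l) : TendstoZeroInProb P (fun i => Y (k i)) l' := fun ε hε =>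
  (hY ε hε).comp hk

lemma tendstoZeroInProb_of_lintegral (hY : ∀ i, Measurable (Y i))
    (h : Tendsto (fun i => ∫⁻ ω, Y i ω ∂P) l (𝓝 0)) : TendstoZeroInProb P Y l := by
  intro ε hε
  -- Since `ε` may be `⊤`, Markov's inequality is applied at the finite threshold `min ε 1`.
  have hε1 : min ε 1 ≠ 0 := (lt_min hε one_pos).ne'
  have hε2 : min ε 1 ≠ ⊤ := ((min_le_right _ _).trans_lt ENNReal.one_lt_top).ne
  have := ENNReal.Tendsto.const_mul (a := (min ε 1)⁻¹) h (Or.inr (by simpa using hε1))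
  rw [mul_zero] at this
  refine tendsto_of_tendsto_of_tendsto_of_le_of_le tendsto_const_nhds this (fun _ => zero_le)
    fun i => ?_
  have h1 := mul_meas_ge_le_lintegral₀ (μ := P) (hY i).aemeasurable (min ε 1)
  rw [mul_comm, ← ENNReal.le_div_iff_mul_le (Or.inl hε1) (Or.inl hε2), ENNReal.div_eq_inv_mul] at h1
  exact (measure_mono fun ω (hω : ε ≤ Y i ω) => (min_le_left ε 1).trans hω).trans h1

lemma tendstoZeroInProb_of_ae [IsFiniteMeasure P] {Y : ℕ → Ω → ℝ≥0∞} (hY : ∀ i, Measurable (Y i))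
    (h : ∀ᵐ ω ∂P, Tendsto (fun i => Y i ω) atTop (𝓝 0)) : TendstoZeroInProb P Y atTop := by
  have h1 : TendstoZeroInProb P (fun i ω => min (Y i ω) 1) atTop := by
    refine tendstoZeroInProb_of_lintegral (fun i => (hY i).min measurable_const) ?_
    have := tendsto_lintegral_of_dominated_convergence (μ := P) (F := fun i ω => min (Y i ω) 1)
      (f := fun _ => 0) (fun _ => 1) (fun i => (hY i).min measurable_const)
      (fun i => ae_of_all _ fun ω => min_le_right _ _) (by simp) (by
        filter_upwards [h] with ω hω
        simpa using hω.min (tendsto_const_nhds (x := (1 : ℝ≥0∞))))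
    simpa using this
  intro ε hε
  refine tendsto_of_tendsto_of_tendsto_of_le_of_le tendsto_const_nhds
    (h1 (min ε 1) (lt_min hε one_pos)) (fun _ => zero_le)
    fun i => measure_mono fun ω (hω : ε ≤ Y i ω) => min_le_min_right 1 hω

lemma TendstoZeroInProb.exists_seq_tendsto_ae {Y : ℕ → Ω → ℝ≥0∞}
    (h : TendstoZeroInProb P Y atTop) :
    ∃ ns : ℕ → ℕ, StrictMono ns ∧ ∀ᵐ ω ∂P, Tendsto (fun i => Y (ns i) ω) atTop (𝓝 0) := by
  have h1 : TendstoInMeasure P (fun i ω => (min (Y i ω) 1).toReal) atTop fun _ => 0 := by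
    rw [tendstoInMeasure_iff_norm]
    intro ε hε
    refine tendsto_of_tendsto_of_tendsto_of_le_of_le tendsto_const_nhds
      (h (ENNReal.ofReal ε) (ENNReal.ofReal_pos.2 hε)) (fun _ => zero_le)
      fun i => measure_mono fun ω hω => ?_
    have hω : ε ≤ ‖(min (Y i ω) 1).toReal - 0‖ := hω
    rw [sub_zero, Real.norm_of_nonneg ENNReal.toReal_nonneg] at hω
    exact (ENNReal.ofReal_le_of_le_toReal hω).trans (min_le_left _ _)
  obtain ⟨ns, hns, hae⟩ := h1.exists_seq_tendsto_ae
  refine ⟨ns, hns, ?_⟩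
  filter_upwards [hae] with ω hω
  have hω' := (ENNReal.tendsto_toReal_iff (fun i => ((min_le_right (Y (ns i) ω) 1).trans_lt
    ENNReal.one_lt_top).ne) (by simp : (0 : ℝ≥0∞) ≠ ⊤)).1 (by simpa using hω)
  refine hω'.congr' ?_
  filter_upwards [hω'.eventually_lt_const one_pos] with i hi
  exact min_eq_left (by_contra fun hc => by
    rw [min_eq_right (not_le.1 hc).le] at hi; exact lt_irrefl _ hi)

end ConvergenceInProbability

/-! ### Convergence of squared integrals along a path. -/

section SqInt

lemma sqInt_mono {f g : ℝ≥0 → ℝ} (h : ∀ s, |f s| ≤ |g s|) (u v : ℝ≥0) :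
    sqInt f u v ≤ sqInt g u v :=
  lintegral_mono fun _ => ENNReal.ofReal_le_ofReal (sq_le_sq.2 (h _))

lemma sqInt_eq_lintegral_enorm (f : ℝ≥0 → ℝ) (u v : ℝ≥0) :
    sqInt f u v = ∫⁻ s in Set.Ioc (u : ℝ) v, ‖f s.toNNReal‖ₑ ^ (2 : ℝ) := by
  refine lintegral_congr fun s => ?_
  rw [← Real.enorm_of_nonneg (sq_nonneg _), enorm_pow]
  norm_cast

lemma sqInt_rpow_half_le {f g : ℝ≥0 → ℝ} (hf : Measurable f) (hg : Measurable g) (u v : ℝ≥0) :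
    sqInt f u v ^ (1 / 2 : ℝ) ≤
      sqInt (fun s => f s - g s) u v ^ (1 / 2 : ℝ) + sqInt g u v ^ (1 / 2 : ℝ) := by
  simp only [sqInt_eq_lintegral_enorm]
  refine le_trans ?_ (ENNReal.lintegral_Lp_add_le (μ := volume.restrict (Set.Ioc (u : ℝ) v))
    (f := fun s => ‖f s.toNNReal - g s.toNNReal‖ₑ) (g := fun s => ‖g s.toNNReal‖ₑ)
    (by fun_prop) (by fun_prop) (p := 2) one_le_two)
  gcongr with s
  simpa using enorm_add_le (f s.toNNReal - g s.toNNReal) (g s.toNNReal)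

/-- The reverse triangle inequality for the `L²` norm, from Minkowski in both directions; finiteness
of the limit makes the truncated subtraction continuous. -/
lemma tendsto_sqInt {f : ℕ → ℝ≥0 → ℝ} {g : ℝ≥0 → ℝ} (hf : ∀ i, Measurable (f i))
    (hg : Measurable g) {u v : ℝ≥0} (hgt : sqInt g u v ≠ ⊤)
    (h : Tendsto (fun i => sqInt (fun s => f i s - g s) u v) atTop (𝓝 0)) :
    Tendsto (fun i => sqInt (f i) u v) atTop (𝓝 (sqInt g u v)) := by
  have hd : Tendsto (fun i => sqInt (fun s => f i s - g s) u v ^ (1 / 2 : ℝ)) atTop (𝓝 0) := by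
    have := h.ennrpow_const (1 / 2 : ℝ)
    rwa [ENNReal.zero_rpow_of_pos (by norm_num)] at this
  have hgt' : sqInt g u v ^ (1 / 2 : ℝ) ≠ ⊤ := ENNReal.rpow_ne_top_of_nonneg (by norm_num) hgt
  have h1 : Tendsto (fun i => sqInt (f i) u v ^ (1 / 2 : ℝ)) atTop
      (𝓝 (sqInt g u v ^ (1 / 2 : ℝ))) := by
    have hlow := ENNReal.Tendsto.sub (tendsto_const_nhds (x := sqInt g u v ^ (1 / 2 : ℝ))) hd
      (Or.inl hgt')
    have hup := hd.add_const (sqInt g u v ^ (1 / 2 : ℝ))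
    rw [tsub_zero] at hlow
    rw [zero_add] at hup
    refine tendsto_of_tendsto_of_tendsto_of_le_of_le hlow hup (fun i => ?_)
      fun i => sqInt_rpow_half_le (hf i) hg u v
    have := sqInt_rpow_half_le hg (hf i) u v
    rw [sqInt_sub_comm] at this
    exact tsub_le_iff_left.2 this
  have h2 := h1.ennrpow_const 2
  simpa only [← ENNReal.rpow_mul, one_div, inv_mul_cancel₀ (two_ne_zero (α := ℝ)),
    ENNReal.rpow_one] using h2

lemma tendsto_sqInt_clip {f : ℝ≥0 → ℝ} (hf : Measurable f) (hf0 : ∀ s, 0 ≤ f s) {u v : ℝ≥0}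
    (hft : sqInt f u v ≠ ⊤) :
    Tendsto (fun M : ℕ => sqInt (fun s => min (f s) M - f s) u v) atTop (𝓝 0) := by
  have := tendsto_lintegral_of_dominated_convergence (μ := volume.restrict (Set.Ioc (u : ℝ) v))
    (F := fun (M : ℕ) s => ENNReal.ofReal ((min (f s.toNNReal) M - f s.toNNReal) ^ 2))
    (f := fun _ => 0) (fun s => ENNReal.ofReal (f s.toNNReal ^ 2)) (fun i => by fun_prop)
    (fun M => ae_of_all _ fun s => ENNReal.ofReal_le_ofReal ?_) hft (ae_of_all _ fun s => ?_)
  · simpa only [sqInt, lintegral_zero] using this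
  · rw [sq_le_sq, abs_of_nonneg (hf0 _), abs_le]
    constructor
    · linarith [le_min (hf0 s.toNNReal) (Nat.cast_nonneg M)]
    · linarith [min_le_left (f s.toNNReal) M, hf0 s.toNNReal]
  · obtain ⟨N, hN⟩ := exists_nat_ge (f s.toNNReal)
    refine tendsto_const_nhds.congr' ?_
    filter_upwards [eventually_ge_atTop N] with M hM
    rw [min_eq_left (hN.trans (by exact_mod_cast hM))]
    simp

lemma sqInt_lt_top_of_bounded {f : ℝ≥0 → ℝ} {C : ℝ} (h : ∀ s, |f s| ≤ C) (u v : ℝ≥0) :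
    sqInt f u v < ⊤ :=
  (sqInt_mono (g := fun _ => C) (fun s => (h s).trans (le_abs_self C)) u v).trans_lt
    (by rw [sqInt_const]; exact ENNReal.ofReal_lt_top)

end SqInt

/-! ### Approximation of a stationary volatility by samplings. -/

section Stationary

variable {P : Measure Ω} {σ : ℝ≥0 → Ω → ℝ}

lemma measurable_path {f : ℝ≥0 → Ω → ℝ} (hf : Measurable (Function.uncurry f)) (ω : Ω) :
    Measurable fun s => f s ω := hf.comp measurable_prodMk_right

/-- A simple process is bounded, so its squared integral is finite. Where that of `σ` is infinite,
the distance to every approximant is infinite too, an event whose probability must vanish. -/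
lemma ae_sqInt_lt_top_of_isItoIntegral [IsProbabilityMeasure P] {F : Filtration ℝ≥0 m}
    {W : ℝ≥0 → Ω → ℝ} {I : Ω → ℝ} {T : ℝ≥0} (hσ : Measurable (Function.uncurry σ))
    (h : IsItoIntegral F P W σ T I) : ∀ᵐ ω ∂P, sqInt (fun s => σ s ω) 0 T < ⊤ := by
  obtain ⟨H, hH, -⟩ := h
  have hk (k : ℕ) : P {ω | ¬ sqInt (fun s => σ s ω) 0 T < ⊤} ≤
      P {ω | 1 ≤ sqIntegral (fun s => (H k).eval s ω - σ s ω) T} := by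
    refine measure_mono fun ω hω => ?_
    by_contra hcon
    have h1 : sqIntegral (fun s => (H k).eval s ω - σ s ω) T < 1 := not_le.1 hcon
    refine hω ?_
    have h2 := sqInt_le_two_mul_add (f := fun s => σ s ω) (g := fun _ => 0)
      (k := fun s => (H k).eval s ω) (measurable_path hσ ω)
      (measurable_path (H k).measurable_uncurry_eval ω) 0 T
    simp only [sub_zero] at h2
    refine h2.trans_lt (ENNReal.mul_lt_top (by simp) (ENNReal.add_lt_top.2 ⟨?_, ?_⟩))
    · rw [sqInt_sub_comm]
      exact h1.trans ENNReal.one_lt_top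
    · obtain ⟨C, -, hC⟩ := (H k).exists_abs_eval_le
      exact sqInt_lt_top_of_bounded (fun s => hC s ω) _ _
  exact le_antisymm (ge_of_tendsto' (hH 1 one_pos) hk) zero_le

/-- After Tonelli, only the joint law of `σ` at two times enters for each `s`, and stationarity
shifts it. -/
lemma lintegral_sqInt_eq_of_isStationary [SFinite P] (hσ : Measurable (Function.uncurry σ))
    (hst : IsStationary σ P) {g : ℝ → ℝ} (hg : Measurable g) (a δ : ℝ≥0) :
    ∫⁻ ω, sqInt (fun s => g (σ s ω) - g (σ a ω)) a (a + δ) ∂P =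
      ∫⁻ ω, sqInt (fun s => g (σ s ω) - g (σ 0 ω)) 0 δ ∂P := by
  have hswap (b u v : ℝ≥0) : ∫⁻ ω, sqInt (fun s => g (σ s ω) - g (σ b ω)) u v ∂P =
      ∫⁻ s in Set.Ioc (u : ℝ) v, ∫⁻ ω, ENNReal.ofReal ((g (σ s.toNNReal ω) - g (σ b ω)) ^ 2) ∂P := by
    refine lintegral_lintegral_swap (Measurable.aemeasurable ?_)
    have h1 : Measurable fun p : Ω × ℝ => σ p.2.toNNReal p.1 :=
      hσ.comp (measurable_snd.real_toNNReal.prodMk measurable_fst)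
    have h2 : Measurable fun p : Ω × ℝ => σ b p.1 :=
      hσ.comp (measurable_const.prodMk measurable_fst)
    exact (((hg.comp h1).sub (hg.comp h2)).pow_const 2).ennreal_ofReal
  rw [hswap, hswap]
  have := (measurePreserving_add_right volume (a : ℝ)).setLIntegral_comp_preimage_emb
    (measurableEmbedding_addRight (a : ℝ))
    (fun s => ∫⁻ ω, ENNReal.ofReal ((g (σ s.toNNReal ω) - g (σ a ω)) ^ 2) ∂P)
    (Set.Ioc (a : ℝ) ((a + δ : ℝ≥0) : ℝ))
  rw [← this, Set.preimage_add_const_Ioc, sub_self, NNReal.coe_add, add_sub_cancel_left]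
  refine setLIntegral_congr_fun measurableSet_Ioc fun s hs => ?_
  have h0 : (s + a).toNNReal = s.toNNReal + a := by
    rw [Real.toNNReal_add hs.1.le a.coe_nonneg, Real.toNNReal_coe]
  have h1 := ((hst a).comp (u := fun x : ℝ≥0 → ℝ =>
    ENNReal.ofReal ((g (x s.toNNReal) - g (x 0)) ^ 2)) (by fun_prop)).lintegral_eq
  simp only [Function.comp_def, zero_add] at h1
  simp only [h0, h1]

/-- Bounded convergence for the clipped volatility near time `0`. -/
lemma tendsto_lintegral_sqInt_clip [IsProbabilityMeasure P] (hσ : Measurable (Function.uncurry σ))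
    (hσ0 : ∀ t ω, 0 ≤ σ t ω) (hA : WeaklyContAtZero σ P) (M : ℕ) :
    Tendsto (fun δ : ℝ≥0 => (δ : ℝ≥0∞)⁻¹ *
      ∫⁻ ω, sqInt (fun s => min (σ s ω) M - min (σ 0 ω) M) 0 δ ∂P) (𝓝[>] 0) (𝓝 0) := by
  rw [ENNReal.tendsto_nhds_zero]
  intro ε hε
  have hε2 : 0 < ε / 2 := ENNReal.half_pos hε.ne'
  have h1 := ENNReal.Tendsto.const_mul (a := ENNReal.ofReal ((M : ℝ) ^ 2)) (hA (ε / 2) hε2)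
    (Or.inr ENNReal.ofReal_ne_top)
  rw [mul_zero, ENNReal.tendsto_nhds_zero] at h1
  filter_upwards [h1 (ε / 2) hε2, self_mem_nhdsWithin] with δ hδ hδ0
  have hδ0 : (0 : ℝ≥0) < δ := hδ0
  set Y : Ω → ℝ≥0∞ := fun ω => (δ : ℝ≥0∞)⁻¹ * sqIntegral (fun s => σ s ω - σ 0 ω) δ with hYdef
  have hY : Measurable Y := by
    refine Measurable.const_mul (measurable_sqInt (f := fun s ω => σ s ω - σ 0 ω) ?_ 0 δ) _
    exact hσ.sub (hσ.comp (measurable_const.prodMk measurable_snd))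
  have hset : MeasurableSet {ω | ε / 2 ≤ Y ω} := measurableSet_le measurable_const hY
  rw [← lintegral_const_mul' _ _ (by simpa using hδ0.ne')]
  -- Where the averaged squared distance `Y` is below `ε / 2`, clipping, being 1-Lipschitz, keeps it
  -- so; on the remaining small event the clipped average is at most `M²`.
  calc _ ≤ ∫⁻ ω, (ε / 2 + {ω | ε / 2 ≤ Y ω}.indicator
          (fun _ => ENNReal.ofReal ((M : ℝ) ^ 2)) ω) ∂P := by
        refine lintegral_mono fun ω => ?_
        by_cases hω : ε / 2 ≤ Y ω
        · rw [Set.indicator_of_mem (s := {ω | ε / 2 ≤ Y ω}) hω]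
          refine le_trans ?_ le_add_self
          have : sqInt (fun s => min (σ s ω) M - min (σ 0 ω) M) 0 δ ≤
              ENNReal.ofReal ((M : ℝ) ^ 2) * δ := by
            refine (sqInt_mono (g := fun _ => (M : ℝ)) (fun s => ?_) 0 δ).trans ?_
            · rw [Nat.abs_cast, abs_le]
              have := le_min (hσ0 s ω) (Nat.cast_nonneg (α := ℝ) M)
              have := le_min (hσ0 0 ω) (Nat.cast_nonneg (α := ℝ) M)
              have := min_le_right (σ s ω) M
              have := min_le_right (σ 0 ω) M
              constructor <;> linarith
            · rw [sqInt_const, NNReal.coe_zero, sub_zero, ENNReal.ofReal_mul (sq_nonneg _),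
                ENNReal.ofReal_coe_nnreal]
          refine (mul_le_mul_right this _).trans ?_
          rw [mul_comm, mul_assoc, ENNReal.mul_inv_cancel (by simpa using hδ0.ne') (by simp),
            mul_one]
        · refine le_trans ?_ le_self_add
          refine le_trans (mul_le_mul_right (sqInt_mono (g := fun s => σ s ω - σ 0 ω)
            (fun s => ?_) 0 δ) _) (not_le.1 hω).le
          exact (abs_min_sub_min_le_max _ _ _ _).trans (by simp)
    _ = ε / 2 + ENNReal.ofReal ((M : ℝ) ^ 2) * P {ω | ε / 2 ≤ Y ω} := by
        rw [lintegral_add_left measurable_const, lintegral_indicator_const hset]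
        simp
    _ ≤ ε := by
        refine (add_le_add_right hδ _).trans ?_
        rw [ENNReal.add_halves]

variable {F : Filtration ℝ≥0 m}

/-- The sampled processes converge to the clipped volatility, in mean square. -/
lemma tendsto_lintegral_sqInt_sampling [IsProbabilityMeasure P] (hσ : IsProgressive F σ)
    (hσ0 : ∀ t ω, 0 ≤ σ t ω) (hst : IsStationary σ P) (hA : WeaklyContAtZero σ P)
    (t : ℝ≥0) {h : ℝ≥0} (hh : 0 < h) (M : ℕ) :
    Tendsto (fun n : ℕ => ∫⁻ ω, sqInt (fun s => (sampling hσ.adapted hσ0 t h M n).eval s ω -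
      min (σ s ω) M) t (t + h) ∂P) atTop (𝓝 0) := by
  have hm := measurable_uncurry_of_isProgressive hσ
  have hδ : Tendsto (fun n : ℕ => h / ((n : ℝ≥0) + 1)) atTop (𝓝[>] 0) := by
    refine tendsto_nhdsWithin_iff.2 ⟨?_, Eventually.of_forall fun n => ?_⟩
    · rw [← NNReal.tendsto_coe]
      push_cast
      exact (tendsto_const_div_atTop_nhds_zero_nat (h : ℝ)).comp (tendsto_add_atTop_nat 1) |>.congr
        fun n => by simp
    · exact Set.mem_Ioi.2 (by positivity)
  have hlim := ENNReal.Tendsto.const_mul (a := (h : ℝ≥0∞))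
    ((tendsto_lintegral_sqInt_clip hm hσ0 hA M).comp hδ) (Or.inr ENNReal.coe_ne_top)
  rw [mul_zero] at hlim
  refine hlim.congr fun n => ?_
  set K := sampling hσ.adapted hσ0 t h M n with hK
  set δ : ℝ≥0 := h / ((n : ℝ≥0) + 1) with hδdef
  have hδ0 : 0 < δ := by positivity
  have hstep (i : ℕ) : K.time (i + 1) = K.time i + δ := by
    simp only [hK, sampling, ← hδdef]
    push_cast
    ring
  have hpiece (ω : Ω) : sqInt (fun s => K.eval s ω - min (σ s ω) M) t (t + h) =
      ∑ i ∈ Finset.range K.n, sqInt (fun s => min (σ s ω) M - min (σ (K.time i) ω) M)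
        (K.time i) (K.time i + δ) := by
    have h0 : K.time 0 = t := sampling_time_zero hσ.adapted hσ0 t h M n
    have hn : K.time K.n = t + h := sampling_time_n hσ.adapted hσ0 t h M n
    nth_rewrite 1 [← hn, ← h0]
    rw [sqInt_eq_sum _ K.mono]
    refine Finset.sum_congr rfl fun i hi => ?_
    rw [sqInt_sub_comm, ← hstep]
    refine sqInt_congr fun s hs => ?_
    rw [K.eval_eq_coeff (Finset.mem_range.1 hi) hs]
    rfl
  have hmeas (a u v : ℝ≥0) :
      Measurable fun ω => sqInt (fun s => min (σ s ω) M - min (σ a ω) M) u v := by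
    refine measurable_sqInt (f := fun s ω => min (σ s ω) M - min (σ a ω) M) ?_ u v
    exact (hm.min measurable_const).sub
      ((hm.comp (measurable_const.prodMk measurable_snd)).min measurable_const)
  simp only [hpiece]
  rw [lintegral_finsetSum _ fun i _ => hmeas _ _ _]
  -- Every piece contributes as much as the first one on `[0, δ]`, and there are `h / δ` of them;
  -- hence the total is `h` times the average handled above.
  simp only [lintegral_sqInt_eq_of_isStationary hm hst
    (g := fun x => min x (M : ℝ)) (by fun_prop)]
  rw [Finset.sum_const, nsmul_eq_mul, Function.comp_apply, ← mul_assoc]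
  congr 1
  have : (K.n : ℝ≥0) = h * δ⁻¹ := by
    simp only [hK, sampling, hδdef]
    push_cast
    field_simp
  rw [← ENNReal.coe_inv hδ0.ne', ← ENNReal.coe_mul, ← this]
  simp

/-- A sequence of samplings, over `[t, t + h]` and `[0, h]` at once, which approximates the
volatility. -/
lemma exists_sampling_tendstoZeroInProb [IsProbabilityMeasure P] (hσ : IsProgressive F σ)
    (hσ0 : ∀ t ω, 0 ≤ σ t ω) (hst : IsStationary σ P) (hA : WeaklyContAtZero σ P)
    (t : ℝ≥0) {h : ℝ≥0} (hh : 0 < h)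
    (hft : ∀ᵐ ω ∂P, sqInt (fun s => σ s ω) t (t + h) < ⊤)
    (hf0 : ∀ᵐ ω ∂P, sqInt (fun s => σ s ω) 0 h < ⊤) :
    ∃ n : ℕ → ℕ,
      TendstoZeroInProb P (fun k ω => sqInt (fun s =>
        (sampling hσ.adapted hσ0 t h k (n k)).eval s ω - σ s ω) t (t + h)) atTop ∧
      TendstoZeroInProb P (fun k ω => sqInt (fun s =>
        (sampling hσ.adapted hσ0 0 h k (n k)).eval s ω - σ s ω) 0 h) atTop := by
  have hm := measurable_uncurry_of_isProgressive hσ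
  -- Diagonal choice: at clipping level `k`, the mesh is taken fine enough for both windows
  -- simultaneously.
  have hex (k : ℕ) : ∃ n : ℕ,
      ∫⁻ ω, sqInt (fun s => (sampling hσ.adapted hσ0 t h k n).eval s ω - min (σ s ω) k)
        t (t + h) ∂P ≤ ((k : ℝ≥0∞) + 1)⁻¹ ∧
      ∫⁻ ω, sqInt (fun s => (sampling hσ.adapted hσ0 0 h k n).eval s ω - min (σ s ω) k)
        0 (0 + h) ∂P ≤ ((k : ℝ≥0∞) + 1)⁻¹ := by
    have hpos : (0 : ℝ≥0∞) < ((k : ℝ≥0∞) + 1)⁻¹ := by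
      rw [ENNReal.inv_pos]; exact_mod_cast ENNReal.natCast_ne_top (k + 1)
    exact ((ENNReal.tendsto_nhds_zero.1
      (tendsto_lintegral_sqInt_sampling hσ hσ0 hst hA t hh k) _ hpos).and
      (ENNReal.tendsto_nhds_zero.1
      (tendsto_lintegral_sqInt_sampling hσ hσ0 hst hA 0 hh k) _ hpos)).exists
  choose n hn using hex
  have hinv : Tendsto (fun k : ℕ => ((k : ℝ≥0∞) + 1)⁻¹) atTop (𝓝 0) := by
    have := ENNReal.tendsto_inv_nat_nhds_zero.comp (tendsto_add_atTop_nat 1)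
    refine this.congr fun k => by simp
  have main (a : ℝ≥0) (hfa : ∀ᵐ ω ∂P, sqInt (fun s => σ s ω) a (a + h) < ⊤)
      (hb : ∀ k, ∫⁻ ω, sqInt (fun s => (sampling hσ.adapted hσ0 a h k (n k)).eval s ω -
        min (σ s ω) k) a (a + h) ∂P ≤ ((k : ℝ≥0∞) + 1)⁻¹) :
      TendstoZeroInProb P (fun k ω => sqInt (fun s =>
        (sampling hσ.adapted hσ0 a h k (n k)).eval s ω - σ s ω) a (a + h)) atTop := by
    have hc (k : ℕ) : Measurable (Function.uncurry fun s ω => min (σ s ω) (k : ℝ)) :=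
      hm.min measurable_const
    have h1 : TendstoZeroInProb P (fun k ω => sqInt (fun s =>
        (sampling hσ.adapted hσ0 a h k (n k)).eval s ω - min (σ s ω) k) a (a + h)) atTop :=
      tendstoZeroInProb_of_lintegral
        (fun k => measurable_sqInt (f := fun s ω =>
          (sampling hσ.adapted hσ0 a h k (n k)).eval s ω - min (σ s ω) k)
          ((SimpleProc.measurable_uncurry_eval _).sub (hc k)) _ _)
        (tendsto_of_tendsto_of_tendsto_of_le_of_le tendsto_const_nhds hinv (fun _ => zero_le) hb)
    have h2 : TendstoZeroInProb P (fun (k : ℕ) ω => sqInt (fun s => min (σ s ω) k - σ s ω)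
        a (a + h)) atTop := by
      refine tendstoZeroInProb_of_ae (fun k => measurable_sqInt
        (f := fun s ω => min (σ s ω) k - σ s ω) ((hc k).sub hm) _ _) ?_
      filter_upwards [hfa] with ω hω
      exact tendsto_sqInt_clip (measurable_path hm ω) (fun s => hσ0 s ω) hω.ne
    exact (h1.two_mul_add h2).mono fun k ω => sqInt_le_two_mul_add
      (measurable_path (SimpleProc.measurable_uncurry_eval _) ω) (measurable_path (hc k) ω) _ _
  refine ⟨n, main t hft fun k => (hn k).1, ?_⟩
  have := main 0 (by simpa using hf0) fun k => (hn k).2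
  simpa only [zero_add] using this

end Stationary

lemma tendstoInMeasure_sub {P : Measure Ω} {ι : Type*} {l : Filter ι} {f g : ι → Ω → ℝ}
    {a b : Ω → ℝ} (hf : TendstoInMeasure P f l a) (hg : TendstoInMeasure P g l b) :
    TendstoInMeasure P (fun i ω => f i ω - g i ω) l fun ω => a ω - b ω := by
  rw [tendstoInMeasure_iff_norm] at *
  intro ε hε
  have := (hf (ε / 2) (half_pos hε)).add (hg (ε / 2) (half_pos hε))
  rw [add_zero] at this
  refine tendsto_of_tendsto_of_tendsto_of_le_of_le tendsto_const_nhds this (fun _ => zero_le)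
    fun i => (measure_mono fun ω (hω : ε ≤ ‖f i ω - g i ω - (a ω - b ω)‖) => ?_).trans
      (measure_union_le _ _)
  by_contra hcon
  have h1 : ‖f i ω - a ω‖ < ε / 2 := not_le.1 fun h => hcon (Or.inl h)
  have h2 : ‖g i ω - b ω‖ < ε / 2 := not_le.1 fun h => hcon (Or.inr h)
  have h3 : ‖f i ω - g i ω - (a ω - b ω)‖ ≤ ‖f i ω - a ω‖ + ‖g i ω - b ω‖ := by
    rw [show f i ω - g i ω - (a ω - b ω) = (f i ω - a ω) - (g i ω - b ω) by ring]
    exact norm_sub_le _ _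
  linarith

lemma tendsto_integral_cexp_mul_I {P : Measure Ω} [IsProbabilityMeasure P] {Z : ℕ → Ω → ℝ}
    {Y : Ω → ℝ} (hZ : ∀ k, Measurable (Z k))
    (h : ∀ᵐ ω ∂P, Tendsto (fun k => Z k ω) atTop (𝓝 (Y ω))) (u : ℝ) :
    Tendsto (fun k => ∫ ω, Complex.exp (u * (Z k ω : ℝ) * Complex.I) ∂P) atTop
      (𝓝 (∫ ω, Complex.exp (u * (Y ω : ℝ) * Complex.I) ∂P)) := by
  refine tendsto_integral_of_dominated_convergence (fun _ => 1) (fun k => ?_)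
    (integrable_const _) (fun k => ae_of_all _ fun ω => ?_) ?_
  · have := hZ k
    exact Measurable.aestronglyMeasurable (by fun_prop)
  · rw [← Complex.ofReal_mul, Complex.norm_exp_ofReal_mul_I]
  · filter_upwards [h] with ω hω
    have hc : Continuous fun x : ℝ => Complex.exp (u * x * Complex.I) := by fun_prop
    exact (hc.tendsto _).comp hω

lemma norm_cexp_neg_le_one {v : ℝ} (hv : 0 ≤ v) (u : ℝ) :
    ‖Complex.exp (-((v : ℂ) * (u : ℂ) ^ 2 / 2))‖ ≤ 1 := by
  rw [show -((v : ℂ) * (u : ℂ) ^ 2 / 2) = ((-(v * u ^ 2 / 2) : ℝ) : ℂ) by push_cast; ring,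
    Complex.norm_exp_ofReal, Real.exp_le_one_iff]
  have := mul_nonneg hv (sq_nonneg u)
  linarith

lemma tendsto_integral_cexp_neg {P : Measure Ω} [IsProbabilityMeasure P] {V : ℕ → Ω → ℝ≥0∞}
    {V' : Ω → ℝ≥0∞} (hV : ∀ k, Measurable (V k)) (hV' : ∀ᵐ ω ∂P, V' ω < ⊤)
    (h : ∀ᵐ ω ∂P, Tendsto (fun k => V k ω) atTop (𝓝 (V' ω))) (u : ℝ) :
    Tendsto (fun k => ∫ ω, Complex.exp (-((V k ω).toReal * u ^ 2 / 2)) ∂P) atTop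
      (𝓝 (∫ ω, Complex.exp (-((V' ω).toReal * u ^ 2 / 2)) ∂P)) := by
  refine tendsto_integral_of_dominated_convergence (fun _ => 1) (fun k => ?_)
    (integrable_const _) (fun k => ae_of_all _ fun ω => ?_) ?_
  · have := (hV k).ennreal_toReal
    exact Measurable.aestronglyMeasurable (by fun_prop)
  · exact norm_cexp_neg_le_one ENNReal.toReal_nonneg u
  · filter_upwards [h, hV'] with ω hω hω'
    have hc : Continuous fun x : ℝ => Complex.exp (-(x * u ^ 2 / 2)) := by fun_prop
    exact (hc.tendsto _).comp ((ENNReal.tendsto_toReal hω'.ne).comp hω)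

/-! ### Increments of `X` as Gaussian mixtures. -/

section Increment

variable {P : Measure Ω} [IsProbabilityMeasure P] {F : Filtration ℝ≥0 m} {W σ X : ℝ≥0 → Ω → ℝ}

/-- An increment of an Itô integral is the limit in probability of elementary integrals of any
simple processes which approximate the integrand. -/
lemma tendstoInMeasure_integral_increment (hW : IsBrownianFor F W P) (hσ : IsProgressive F σ)
    (hX : ∀ t, IsItoIntegral F P W σ t (fun ω => X t ω - X 0 ω)) {t T : ℝ≥0} (htT : t ≤ T)
    {K : ℕ → SimpleProc F}
    (hK : TendstoZeroInProb P (fun k ω => sqInt (fun s => (K k).eval s ω - σ s ω) t T) atTop) :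
    TendstoInMeasure P (fun k ω => (K k).integral W T ω - (K k).integral W t ω) atTop
      fun ω => X T ω - X t ω := by
  have hm := measurable_uncurry_of_isProgressive hσ
  obtain ⟨H, hH, hHI⟩ := hX T
  obtain ⟨G, hG, hGI⟩ := hX t
  have h1 : TendstoZeroInProb P
      (fun k ω => sqInt (fun r => (H k).eval r ω - (G k).eval r ω) 0 t) atTop := by
    refine ((hH.mono (Z := fun k ω => sqInt (fun s => (H k).eval s ω - σ s ω) 0 t)
      fun k ω => sqInt_mono_set _ le_rfl htT).two_mul_add hG).mono fun k ω => ?_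
    rw [sqIntegral_eq_sqInt, sqInt_sub_comm (fun s => (G k).eval s ω)]
    exact sqInt_le_two_mul_add (measurable_path (H k).measurable_uncurry_eval ω)
      (measurable_path hm ω) _ _
  have h2 : TendstoZeroInProb P
      (fun k ω => sqInt (fun r => (H k).eval r ω - (K k).eval r ω) t T) atTop := by
    refine ((hH.mono (Z := fun k ω => sqInt (fun s => (H k).eval s ω - σ s ω) t T)
      fun k ω => sqInt_mono_set _ zero_le le_rfl).two_mul_add hK).mono fun k ω => ?_
    rw [sqInt_sub_comm (fun s => (K k).eval s ω)]
    exact sqInt_le_two_mul_add (measurable_path (H k).measurable_uncurry_eval ω)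
      (measurable_path hm ω) _ _
  -- The integrals telescope: `H` over `[0, T]`, minus `G` over `[0, t]`, minus `H - G` over `[0,
  -- t]`, minus `H - K` over `[t, T]`, is `K` over `[t, T]`. The last two subtracted terms tend to
  -- zero.
  have h3 := tendstoInMeasure_sub (tendstoInMeasure_sub (tendstoInMeasure_sub hHI hGI)
    (hW.tendstoInMeasure_integral_sub zero_le h1)) (hW.tendstoInMeasure_integral_sub htT h2)
  refine (h3.congr_right (ae_of_all _ fun ω => ?_)).congr_left fun k => ae_of_all _ fun ω => ?_
  · ring
  · simp only [SimpleProc.integral_zero_right]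
    ring

/-- The increments of `X` are mixtures of centered Gaussians. -/
lemma charFun_increment (hW : IsBrownianFor F W P) (hσ0 : ∀ t ω, 0 ≤ σ t ω)
    (hσ : IsProgressive F σ) (hst : IsStationary σ P)
    (hind : IndepFun (fun ω t => σ t ω) (fun ω t => W t ω) P)
    (hX : ∀ t, IsItoIntegral F P W σ t (fun ω => X t ω - X 0 ω)) (hA : WeaklyContAtZero σ P)
    (t : ℝ≥0) {h : ℝ≥0} (hh : 0 < h) :
    AEMeasurable (fun ω => X (t + h) ω - X t ω) P ∧
    ∀ u : ℝ, ∫ ω, Complex.exp (u * (X (t + h) ω - X t ω : ℝ) * Complex.I) ∂P =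
      ∫ ω, Complex.exp (-((sqInt (fun s => σ s ω) 0 h).toReal * u ^ 2 / 2)) ∂P := by
  have hm := measurable_uncurry_of_isProgressive hσ
  have hf0 := ae_sqInt_lt_top_of_isItoIntegral hm (hX h)
  have hft : ∀ᵐ ω ∂P, sqInt (fun s => σ s ω) t (t + h) < ⊤ := by
    filter_upwards [ae_sqInt_lt_top_of_isItoIntegral hm (hX (t + h))] with ω hω
    exact (sqInt_mono_set _ zero_le le_rfl).trans_lt hω
  obtain ⟨n, hnt, hn0⟩ := exists_sampling_tendstoZeroInProb hσ hσ0 hst hA t hh hft hf0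
  have hZ := tendstoInMeasure_integral_increment hW hσ hX (le_self_add : t ≤ t + h) hnt
  have hZm (k : ℕ) : Measurable fun ω =>
      (sampling hσ.adapted hσ0 t h k (n k)).integral W (t + h) ω -
        (sampling hσ.adapted hσ0 t h k (n k)).integral W t ω :=
    ((SimpleProc.measurable_integral _ hW.measurable _).sub
      (SimpleProc.measurable_integral _ hW.measurable _))
  refine ⟨hZ.aemeasurable fun k => (hZm k).aemeasurable, fun u => ?_⟩
  obtain ⟨ns, hns, hae⟩ := hZ.exists_seq_tendsto_ae
  -- A second extraction gives one subsequence along which both windows converge almost surely.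
  obtain ⟨ms, hms, hae0⟩ := (hn0.comp hns.tendsto_atTop).exists_seq_tendsto_ae
  have hlim1 := tendsto_integral_cexp_mul_I (fun k => hZm (ns (ms k)))
    (by filter_upwards [hae] with ω hω using hω.comp hms.tendsto_atTop) u
  have hlim2 := tendsto_integral_cexp_neg (P := P)
    (V := fun k ω => sqInt (fun s =>
      (sampling hσ.adapted hσ0 0 h (ns (ms k)) (n (ns (ms k)))).eval s ω) 0 h)
    (fun k => measurable_sqInt (SimpleProc.measurable_uncurry_eval _) _ _) hf0 (by
      filter_upwards [hae0, hf0] with ω hω hω'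
      exact tendsto_sqInt (fun k => measurable_path (SimpleProc.measurable_uncurry_eval _) ω)
        (measurable_path hm ω) hω'.ne hω) u
  refine tendsto_nhds_unique hlim1 (hlim2.congr fun k => ?_)
  rw [integral_cexp_sampling hσ.adapted hσ0 t h _ _ hW hind u]
  exact ((identDistrib_sqInt_sampling hσ.adapted hσ0 t h (ns (ms k)) (n (ns (ms k))) hst).comp
    (u := fun v : ℝ≥0∞ => Complex.exp (-(v.toReal * u ^ 2 / 2)))
    (by have := ENNReal.measurable_toReal; fun_prop)).integral_eq.symm

end Increment

/-- A real random variable with the characteristic function of a centered Gaussian mixture. -/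
lemma map_eq_of_charFun_mixture {P : Measure Ω} [IsProbabilityMeasure P] {Y : Ω → ℝ}
    (hY : AEMeasurable Y P) {V : Ω → ℝ≥0∞} (hV : Measurable V)
    (h : ∀ u : ℝ, ∫ ω, Complex.exp (u * (Y ω : ℝ) * Complex.I) ∂P =
      ∫ ω, Complex.exp (-((V ω).toReal * u ^ 2 / 2)) ∂P) :
    P.map Y = (P.prod (gaussianReal 0 1)).map fun p => √(V p.1).toReal * p.2 := by
  have hV' := hV.ennreal_toReal
  have hmeas : Measurable fun p : Ω × ℝ => √(V p.1).toReal * p.2 := by fun_prop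
  have := Measure.isProbabilityMeasure_map (μ := P) hY
  have := Measure.isProbabilityMeasure_map (μ := P.prod (gaussianReal 0 1)) hmeas.aemeasurable
  refine Measure.ext_of_charFun (funext fun u => ?_)
  rw [charFun_apply_real, charFun_apply_real, integral_map hY (by fun_prop),
    integral_map hmeas.aemeasurable (by fun_prop), h u, integral_prod]
  · refine integral_congr_ae (ae_of_all _ fun ω => ?_)
    -- For fixed `ω`, scaling a standard Gaussian by `√V` amounts to evaluating its characteristic
    -- function at `u √V`.
    have h1 := charFun_gaussianReal (μ := 0) (v := 1) (u * √(V ω).toReal)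
    rw [charFun_apply_real] at h1
    have h2 : ((√(V ω).toReal : ℝ) : ℂ) ^ 2 = ((V ω).toReal : ℂ) := by
      rw [← Complex.ofReal_pow, Real.sq_sqrt ENNReal.toReal_nonneg]
    calc _ = Complex.exp (-(((V ω).toReal : ℂ) * u ^ 2 / 2)) := rfl
      _ = _ := by rw [← h2]; congr 1; push_cast; ring
      _ = _ := h1.symm
      _ = _ := by
        refine integral_congr_ae (ae_of_all _ fun x => ?_)
        simp only
        congr 1
        push_cast
        ring
  · refine .of_bound (Measurable.aestronglyMeasurable (by fun_prop)) 1 (ae_of_all _ fun p => ?_)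
    rw [← Complex.ofReal_mul, Complex.norm_exp_ofReal_mul_I]

/-! ### Absolute moments of Gaussian mixtures. -/

/-- The absolute moment of order `q` of a standard Gaussian variable. -/
noncomputable def gaussianMoment (q : ℝ) : ℝ≥0∞ := ∫⁻ x, ENNReal.ofReal |x| ^ q ∂gaussianReal 0 1

lemma gaussianMoment_ne_zero {q : ℝ} (hq : 0 < q) : gaussianMoment q ≠ 0 := by
  intro h0
  rw [gaussianMoment, lintegral_eq_zero_iff (by fun_prop)] at h0
  have : NullSingletonClass (gaussianReal 0 1) := nullSingletonClass_gaussianReal one_ne_zero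
  have h1 : ∀ᵐ x ∂gaussianReal 0 1, x ∈ ({0} : Set ℝ) := by
    filter_upwards [h0] with x hx
    simpa [hq.le, hq, not_lt.2 hq.le, ENNReal.rpow_eq_zero_iff] using hx
  have h2 : gaussianReal 0 1 ({0} : Set ℝ)ᶜ = 0 := h1
  rw [prob_compl_eq_zero_iff (measurableSet_singleton _), measure_singleton] at h2
  exact zero_ne_one h2

lemma gaussianMoment_ne_top {q : ℝ} (hq : 0 < q) : gaussianMoment q ≠ ⊤ := by
  have h := memLp_id_gaussianReal (μ := 0) (v := 1) q.toNNReal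
  have := lintegral_rpow_enorm_lt_top_of_eLpNorm_lt_top (by simpa using hq) (by simp) h.2
  rw [ENNReal.coe_toReal, Real.coe_toNNReal _ hq.le] at this
  refine (lt_of_le_of_lt (le_of_eq ?_) this).ne
  refine lintegral_congr fun x => ?_
  rw [id, Real.enorm_eq_ofReal_abs]

lemma lintegral_abs_rpow_mixture {P : Measure Ω} [IsProbabilityMeasure P] {Y : Ω → ℝ}
    (hY : AEMeasurable Y P) {V : Ω → ℝ≥0∞} (hV : Measurable V) (hVt : ∀ᵐ ω ∂P, V ω < ⊤)
    (h : P.map Y = (P.prod (gaussianReal 0 1)).map fun p => √(V p.1).toReal * p.2) {q : ℝ}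
    (hq : 0 < q) :
    ∫⁻ ω, ENNReal.ofReal |Y ω| ^ q ∂P = gaussianMoment q * ∫⁻ ω, V ω ^ (q / 2) ∂P := by
  have hV' := hV.ennreal_toReal
  have hmeas : Measurable fun p : Ω × ℝ => √(V p.1).toReal * p.2 := by fun_prop
  have hf : Measurable fun x : ℝ => ENNReal.ofReal |x| ^ q := by fun_prop
  calc _ = ∫⁻ x, ENNReal.ofReal |x| ^ q ∂(P.map Y) := (lintegral_map' hf.aemeasurable hY).symm
    _ = ∫⁻ ω, ∫⁻ x, ENNReal.ofReal |√(V ω).toReal * x| ^ q ∂gaussianReal 0 1 ∂P := by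
        rw [h, lintegral_map hf hmeas]
        exact lintegral_prod _ (hf.comp hmeas).aemeasurable
    _ = ∫⁻ ω, gaussianMoment q * V ω ^ (q / 2) ∂P := by
        refine lintegral_congr_ae ?_
        filter_upwards [hVt] with ω hω
        have h1 : ENNReal.ofReal (√(V ω).toReal) ^ q = V ω ^ (q / 2) := by
          rw [Real.sqrt_eq_rpow, ← ENNReal.ofReal_rpow_of_nonneg ENNReal.toReal_nonneg
            (by norm_num), ENNReal.ofReal_toReal hω.ne, ← ENNReal.rpow_mul]
          congr 1; ring
        rw [gaussianMoment, mul_comm, ← h1, ← lintegral_const_mul _ hf]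
        refine lintegral_congr fun x => ?_
        rw [abs_mul, abs_of_nonneg (Real.sqrt_nonneg _), ENNReal.ofReal_mul (Real.sqrt_nonneg _),
          ENNReal.mul_rpow_of_nonneg _ _ hq.le]
    _ = _ := lintegral_const_mul _ (hV.pow_const _)

/-! ### Two-sided moment bounds for the averaged squared volatility. -/

section Bounds

variable {P : Measure Ω} {σ : ℝ≥0 → Ω → ℝ}

/-- On a probability space, `y ^ q ≤ 1 + y ^ p` lets the higher moment control the lower one. -/
lemma eventually_lintegral_rpow_le [IsProbabilityMeasure P] {ι : Type*} {l : Filter ι} {Y : ι → Ω → ℝ≥0∞} {p q : ℝ}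
    (hq : 0 < q) (hqp : q ≤ p) (hbdd : limsup (fun i => ∫⁻ ω, Y i ω ^ p ∂P) l < ⊤) :
    ∃ C : ℝ≥0∞, C ≠ ⊤ ∧ ∀ᶠ i in l, ∫⁻ ω, Y i ω ^ q ∂P ≤ C := by
  obtain ⟨C, hC, hC'⟩ := exists_between hbdd
  refine ⟨1 + C, by simp [hC'.ne], ?_⟩
  filter_upwards [eventually_lt_of_limsup_lt hC] with i hi
  calc _ ≤ ∫⁻ ω, (1 + Y i ω ^ p) ∂P := by
        refine lintegral_mono fun ω => ?_
        rcases le_total (Y i ω) 1 with h | h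
        · exact (ENNReal.rpow_le_one h hq.le).trans le_self_add
        · exact (ENNReal.rpow_le_rpow_of_exponent_le h hqp).trans le_add_self
    _ = 1 + ∫⁻ ω, Y i ω ^ p ∂P := by rw [lintegral_add_left measurable_const]; simp
    _ ≤ 1 + C := add_le_add_right hi.le 1

lemma exists_measure_lt_of_ne (hσ0 : ∀ t ω, 0 ≤ σ t ω)
    (hne : ¬ (σ 0 =ᵐ[P] 0)) : ∃ δ : ℝ, 0 < δ ∧ P {ω | δ < σ 0 ω} ≠ 0 := by
  by_contra! hcon
  refine hne ?_
  have h1 (n : ℕ) : ∀ᵐ ω ∂P, σ 0 ω ≤ 1 / ((n : ℝ) + 1) := by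
    have := hcon (1 / ((n : ℝ) + 1)) (by positivity)
    rw [ae_iff]
    simpa only [not_le] using this
  filter_upwards [ae_all_iff.2 h1] with ω hω
  exact le_antisymm (ge_of_tendsto' tendsto_one_div_add_atTop_nhds_zero_nat hω) (hσ0 0 ω)

/-- On small intervals the averaged squared volatility does not degenerate. -/
lemma eventually_le_lintegral_rpow [IsProbabilityMeasure P] (hm : Measurable (Function.uncurry σ))
    (hσ0 : ∀ t ω, 0 ≤ σ t ω) (hne : ¬ (σ 0 =ᵐ[P] 0)) (hA : WeaklyContAtZero σ P) {q : ℝ}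
    (hq : 0 < q) :
    ∃ c : ℝ≥0∞, c ≠ 0 ∧ ∀ᶠ h : ℝ≥0 in 𝓝[>] 0,
      c ≤ ∫⁻ ω, ((h : ℝ≥0∞)⁻¹ * sqInt (fun s => σ s ω) 0 h) ^ q ∂P := by
  obtain ⟨δ, hδ, hPδ⟩ := exists_measure_lt_of_ne hσ0 hne
  set a := P {ω | δ < σ 0 ω} with ha
  -- Since `σ_0² ≤ 2 (Y + V)`, where `Y` averages `(σ_s - σ_0)²` and `V` averages `σ_s²`, the event
  -- `σ_0 > δ` excludes that both lie below `δ² / 4`. As `Y` is small in probability, `V ≥ e` keeps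
  -- probability at least `a / 2`.
  set e : ℝ≥0∞ := ENNReal.ofReal (δ ^ 2 / 4) with he
  have he0 : 0 < e := ENNReal.ofReal_pos.2 (by positivity)
  have het : e ≠ ⊤ := ENNReal.ofReal_ne_top
  refine ⟨e ^ q * (a / 2), mul_ne_zero (ENNReal.rpow_pos he0 het).ne'
    (ENNReal.half_pos hPδ).ne', ?_⟩
  filter_upwards [(hA e he0).eventually_le_const (ENNReal.half_pos hPδ), self_mem_nhdsWithin]
    with h hh hh0
  have hh0 : (0 : ℝ≥0) < h := hh0
  set Y : Ω → ℝ≥0∞ := fun ω => (h : ℝ≥0∞)⁻¹ * sqIntegral (fun s => σ s ω - σ 0 ω) h with hY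
  set V : Ω → ℝ≥0∞ := fun ω => (h : ℝ≥0∞)⁻¹ * sqInt (fun s => σ s ω) 0 h with hV
  have hVm : Measurable V := (measurable_sqInt hm 0 h).const_mul _
  have hsub : {ω | δ < σ 0 ω} ⊆ {ω | e ≤ V ω} ∪ {ω | e ≤ Y ω} := by
    intro ω hω
    have hω : δ < σ 0 ω := hω
    by_contra hcon
    have h1 : V ω < e := not_le.1 fun h => hcon (Or.inl h)
    have h2 : Y ω < e := not_le.1 fun h => hcon (Or.inr h)
    have h3 := sqInt_le_two_mul_add (f := fun _ => σ 0 ω) (g := fun _ => 0)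
      (k := fun s => σ s ω) measurable_const (measurable_path hm ω) 0 h
    simp only [sub_zero] at h3
    rw [sqInt_sub_comm, sqInt_const, NNReal.coe_zero, sub_zero, ENNReal.ofReal_mul (sq_nonneg _),
      ENNReal.ofReal_coe_nnreal, ← sqIntegral_eq_sqInt] at h3
    have h4 : ENNReal.ofReal (σ 0 ω ^ 2) ≤ 2 * (Y ω + V ω) := by
      have h5 := mul_le_mul_right h3 (h : ℝ≥0∞)⁻¹
      rw [mul_comm, mul_assoc, ENNReal.mul_inv_cancel (by simpa using hh0.ne') (by simp),
        mul_one] at h5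
      refine h5.trans_eq ?_
      simp only [hY, hV]
      ring
    have h5 : 2 * (Y ω + V ω) ≤ ENNReal.ofReal (δ ^ 2) := by
      calc 2 * (Y ω + V ω) ≤ 2 * (e + e) := by gcongr
        _ = ENNReal.ofReal (δ ^ 2) := by
          rw [he, ← ENNReal.ofReal_add (by positivity) (by positivity),
            show (2 : ℝ≥0∞) = ENNReal.ofReal 2 by simp, ← ENNReal.ofReal_mul (by norm_num)]
          congr 1; ring
    have h6 := (ENNReal.ofReal_le_ofReal_iff (sq_nonneg δ)).1 (h4.trans h5)
    have := pow_lt_pow_left₀ hω hδ.le two_ne_zero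
    linarith
  have hPV : a / 2 ≤ P {ω | e ≤ V ω} := by
    have h1 : a ≤ P {ω | e ≤ V ω} + a / 2 :=
      (measure_mono hsub).trans ((measure_union_le _ _).trans (add_le_add_right hh _))
    have h2 : a / 2 + a / 2 ≤ P {ω | e ≤ V ω} + a / 2 := by rwa [ENNReal.add_halves]
    exact (ENNReal.add_le_add_iff_right (ENNReal.div_ne_top (measure_ne_top P _) (by simp))).1 h2
  calc e ^ q * (a / 2) ≤ e ^ q * P {ω | e ^ q ≤ V ω ^ q} := by
        simp only [ENNReal.rpow_le_rpow_iff hq]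
        gcongr
    _ ≤ _ := mul_meas_ge_le_lintegral₀ (hVm.pow_const q).aemeasurable _

end Bounds

/-! ### From power bounds to the scaling exponent. -/

/-- A function comparable to `h ^ r` near `0` has logarithmic scaling exponent `r`. -/
lemma tendsto_log_div_log {E : ℝ≥0 → ℝ≥0∞} {R : ℝ≥0 → ℝ≥0∞} {c C : ℝ≥0∞} (hc : c ≠ 0)
    (hC : C ≠ ⊤) {r : ℝ} (hE : ∀ᶠ h in 𝓝[>] 0, E h = (h : ℝ≥0∞) ^ r * R h)
    (hcR : ∀ᶠ h in 𝓝[>] 0, c ≤ R h) (hRC : ∀ᶠ h in 𝓝[>] 0, R h ≤ C) :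
    Tendsto (fun h : ℝ≥0 => ENNReal.log (E h) / ((Real.log (h : ℝ) : ℝ) : EReal)) (𝓝[>] 0)
      (𝓝 (r : EReal)) := by
  have hlog : Tendsto (fun h : ℝ≥0 => Real.log (h : ℝ)) (𝓝[>] 0) atBot := by
    refine Real.tendsto_log_nhdsGT_zero.comp (tendsto_nhdsWithin_iff.2 ⟨?_, ?_⟩)
    · exact (NNReal.continuous_coe.tendsto' 0 0 rfl).mono_left nhdsWithin_le_nhds
    · filter_upwards [self_mem_nhdsWithin] with h hh
      exact NNReal.coe_pos.2 hh
  -- The numerator stays between `log c` and `log C` while `log h` tends to `-∞`.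
  have hbd : Tendsto (fun h : ℝ≥0 => Real.log (R h).toReal / Real.log (h : ℝ)) (𝓝[>] 0) (𝓝 0) := by
    simp only [div_eq_mul_inv]
    refine bdd_le_mul_tendsto_zero (b := Real.log c.toReal) (B := Real.log C.toReal) ?_ ?_
      hlog.inv_tendsto_atBot
    · filter_upwards [hcR, hRC] with h h2 h3
      have hRt : R h ≠ ⊤ := ne_top_of_le_ne_top hC h3
      exact Real.log_le_log (ENNReal.toReal_pos hc (ne_top_of_le_ne_top hRt h2))
        (ENNReal.toReal_mono hRt h2)
    · filter_upwards [hcR, hRC] with h h2 h3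
      have hRt : R h ≠ ⊤ := ne_top_of_le_ne_top hC h3
      exact Real.log_le_log (ENNReal.toReal_pos (fun h0 => hc (by simpa [h0] using h2)) hRt)
        (ENNReal.toReal_mono hC h3)
  have hreal : Tendsto (fun h : ℝ≥0 => r + Real.log (R h).toReal / Real.log (h : ℝ)) (𝓝[>] 0)
      (𝓝 r) := by simpa using hbd.const_add r
  refine ((continuous_coe_real_ereal.tendsto r).comp hreal).congr' ?_
  filter_upwards [hE, hcR, hRC, self_mem_nhdsWithin, hlog.eventually_lt_atBot 0]
    with h h1 h2 h3 h4 h5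
  have h4 : (0 : ℝ) < h := NNReal.coe_pos.2 h4
  have hRt : R h ≠ ⊤ := ne_top_of_le_ne_top hC h3
  have hR0 : 0 < (R h).toReal := ENNReal.toReal_pos (fun h0 => hc (by simpa [h0] using h2)) hRt
  have h6 : E h = ENNReal.ofReal ((h : ℝ) ^ r * (R h).toReal) := by
    rw [h1, ENNReal.ofReal_mul (by positivity), ENNReal.ofReal_toReal hRt,
      ← ENNReal.ofReal_rpow_of_pos h4, ENNReal.ofReal_coe_nnreal]
  rw [h6, ENNReal.log_ofReal_of_pos (by positivity), ← EReal.coe_div, Function.comp_apply,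
    Real.log_mul (by positivity) hR0.ne', Real.log_rpow h4, add_div, mul_div_assoc,
    div_self h5.ne, mul_one]

end StochVol

theorem mainTheorem4 {Ω : Type*} {m : MeasurableSpace Ω} (P : Measure Ω) [IsProbabilityMeasure P]
    (F : Filtration ℝ≥0 m) (W σ X : ℝ≥0 → Ω → ℝ)
    (hW : StochVol.IsBrownianFor F W P)
    (hσ_nonneg : ∀ t ω, 0 ≤ σ t ω)
    (hσ_prog : IsProgressive F σ)
    (hσ_stat : StochVol.IsStationary σ P)
    (hσ_indep : IndepFun (fun ω t => σ t ω) (fun ω t => W t ω) P)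
    (hσ_ne : ¬ (σ 0 =ᵐ[P] 0))
    (hX : ∀ t, StochVol.IsItoIntegral F P W σ t (fun ω => X t ω - X 0 ω))
    (hA : StochVol.WeaklyContAtZero σ P)
    (p : ℝ) (hp : 1 < p)
    (hbdd : limsup (fun h : ℝ≥0 =>
      ∫⁻ ω, ((h : ℝ≥0∞)⁻¹ * StochVol.sqIntegral (fun s => σ s ω) h) ^ (p / 2) ∂P) (𝓝[>] 0) < ⊤)
    (q : ℝ) (hq : 0 < q) (hqp : q < p) (t : ℝ≥0) :
    StochVol.scalingExponent P X t q = ((q / 2 : ℝ) : EReal) := by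
  have hm := StochVol.measurable_uncurry_of_isProgressive hσ_prog
  have hq2 : 0 < q / 2 := by positivity
  obtain ⟨C, hC, hRC⟩ := StochVol.eventually_lintegral_rpow_le hq2 (by linarith) hbdd
  obtain ⟨c, hc, hcR⟩ := StochVol.eventually_le_lintegral_rpow hm hσ_nonneg hσ_ne hA hq2
  have hg0 := StochVol.gaussianMoment_ne_zero hq
  have hgt := StochVol.gaussianMoment_ne_top hq
  refine (StochVol.tendsto_log_div_log (c := StochVol.gaussianMoment q * c)
    (C := StochVol.gaussianMoment q * C) (R := fun h => StochVol.gaussianMoment q *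
      ∫⁻ ω, ((h : ℝ≥0∞)⁻¹ * StochVol.sqInt (fun s => σ s ω) 0 h) ^ (q / 2) ∂P)
    (mul_ne_zero hg0 hc) (ENNReal.mul_ne_top hgt hC) ?_ ?_ ?_).limsup_eq
  · filter_upwards [self_mem_nhdsWithin] with h hh
    have hh : (0 : ℝ≥0) < h := hh
    obtain ⟨hY, hchar⟩ := StochVol.charFun_increment hW hσ_nonneg hσ_prog hσ_stat hσ_indep hX hA t hh
    have hV := StochVol.measurable_sqInt hm 0 h
    rw [StochVol.lintegral_abs_rpow_mixture hY hV
      (StochVol.ae_sqInt_lt_top_of_isItoIntegral hm (hX h))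
      (StochVol.map_eq_of_charFun_mixture hY hV hchar) hq, mul_left_comm]
    congr 1
    -- The factor `h ^ (q / 2)` goes back inside the expectation, where it cancels the normalization
    -- `h⁻¹`.
    rw [← lintegral_const_mul _ ((hV.const_mul _).pow_const _)]
    refine lintegral_congr fun ω => ?_
    rw [← ENNReal.mul_rpow_of_nonneg _ _ hq2.le, ← mul_assoc,
      ENNReal.mul_inv_cancel (by simpa using hh.ne') (by simp), one_mul]
  · filter_upwards [hcR] with h hh using mul_le_mul_right hh _
  · filter_upwards [hRC] with h hh using mul_le_mul_right hh _
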